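/- Let $k$ be a field, let $\Sigma=\{x_1,\dots,x_6,y_1,\dots,y_6\}$, and let $\phi:\Sigma^*\to\Sigma^*$ be the morphism of the free monoid given by $$\begin{array}{lll} x_1\mapsto x_1x_2y_1y_2, & x_2\mapsto x_1x_3y_1y_3, & x_3\mapsto x_1x_4y_1y_4,\\ x_4\mapsto x_1x_5y_1y_5, & x_5\mapsto x_1x_6y_1y_6, & x_6\mapsto x_2x_3y_2y_3,\\ y_1\mapsto x_2x_4y_2y_5, & y_2\mapsto x_2x_5y_3y_4, & y_3\mapsto x_2x_6y_2y_6,\\ y_4\mapsto x_3x_4y_3y_5, & y_5\mapsto x_3x_5y_3y_6, & y_6\mapsto x_3x_6y_4y_5. \end{array}$$ Let $w$ be the unique right-infinite word over $\Sigma$ that has first letter $x_1$ and is fixed by $\phi$. Let $A_w$ be the quotient of the free algebra $k\{x_1,\dots,x_6,y_1,\dots,y_6\}$ by the ideal generated by all finite words that are not subwords (blocks of consecutive letters) of $w$. Grade $A_w$ by giving $x_1$ degree $1$ and every other letter degree $2$, and let $R=\bigoplus_{d\ge 1}(A_w)_d$ be its positive part, a $k$-algebra without unit. Then: 1. $R$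 is just infinite (it is infinite-dimensional over $k$, and $R/I$ is finite-dimensional for every nonzero two-sided ideal $I$), and $R$ is a prime ring; 2. $R=\bigoplus_{d\ge 1}(A_w)_d$ is graded nilpotent: for every set $S$ of homogeneous elements of $R$ of the same degree there is an $N\ge 1$ with $S^N=(0)$; 3. $R$ is a finitely generated algebra of quadratic growth: for every finite-dimensional generating subspace $V$ of $R$, $\dim_k(V+V^2+\cdots+V^n)=\Theta(n^2)$; in particular $R$ has Gelfand-Kirillov dimension $2$; 4. the Jacobson radical of $R$ (the largest two-sided ideal that consists of quasi-regular elements) is zero; 5. $R$ is finitely generated as a Lie algebra over $k$ under the bracket $[a,b]=ab-ba$. In particular, $R$ is a graded nilpotent algebra of Gelfand-Kirillov dimension two that is not Jacobson radical, and it is finitely generated as a Lie algebra but is not nilpotent. -/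

import Mathlib

open scoped Pointwise

namespace Iterative

/-! ### Infinite words and their morphisms -/

/-- The prefix of length `n` of the right-infinite word `w = w 0, w 1, w 2, …`. -/
def wordPrefix {X : Type*} (w : ℕ → X) (n : ℕ) : List X :=
  (List.range n).map w

/-- The finite word `u` is a subword (a block of consecutive letters) of the right-infinite
word `w`. -/
def IsSubword {X : Type*} (u : List X) (w : ℕ → X) : Prop :=
  ∃ i : ℕ, u = (List.range u.length).map fun j => w (i + j)

/-- The infinite word `w` is fixed by the morphism of the free monoid that sends each letter `a`
to the word `f a` (and hence a word `u` to `u.flatMap f`): the image of every finite prefix of `w`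
is again a prefix of `w`. -/
def IsFixedPoint {X : Type*} (f : X → List X) (w : ℕ → X) : Prop :=
  ∀ n : ℕ, (wordPrefix w n).flatMap f = wordPrefix w ((wordPrefix w n).flatMap f).length

/-! ### The concrete morphism -/

/-- The alphabet of twelve letters. -/
inductive Letter
  | x1 | x2 | x3 | x4 | x5 | x6 | y1 | y2 | y3 | y4 | y5 | y6
  deriving DecidableEq

open Letter in
/-- The `4`-uniform morphism, given by its values on letters. -/
def φ : Letter → List Letter
  | x1 => [x1, x2, y1, y2]
  | x2 => [x1, x3, y1, y3]
  | x3 => [x1, x4, y1, y4]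
  | x4 => [x1, x5, y1, y5]
  | x5 => [x1, x6, y1, y6]
  | x6 => [x2, x3, y2, y3]
  | y1 => [x2, x4, y2, y5]
  | y2 => [x2, x5, y3, y4]
  | y3 => [x2, x6, y2, y6]
  | y4 => [x3, x4, y3, y5]
  | y5 => [x3, x5, y3, y6]
  | y6 => [x3, x6, y4, y5]

/-- The degrees of the letters: `x1` has degree one, all other letters have degree two. -/
def letterDegree : Letter → ℕ
  | Letter.x1 => 1
  | _ => 2

theorem length_φ (a : Letter) : (φ a).length = 4 := by
  cases a <;> rfl

theorem length_flatMap_φ (u : List Letter) : (u.flatMap φ).length = 4 * u.length := by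
  induction u with
  | nil => rfl
  | cons a u ih =>
    rw [List.flatMap_cons, List.length_append, ih, length_φ, List.length_cons]
    ring

/-- A word is fixed by the morphism iff its `(4n + j)`-th letter is the `j`-th letter of the image
of its `n`-th letter (for `j < 4`, counting from zero). -/
theorem isFixedPoint_φ_iff (w : ℕ → Letter) :
    IsFixedPoint φ w ↔
      ∀ n, φ (w n) = [w (4 * n), w (4 * n + 1), w (4 * n + 2), w (4 * n + 3)] := by
  have hlen : ∀ n, ((wordPrefix w n).flatMap φ).length = 4 * n := by
    intro n
    rw [length_flatMap_φ]
    simp [wordPrefix]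
  have hs : ∀ n, wordPrefix w (n + 1) = wordPrefix w n ++ [w n] := by
    intro n
    simp [wordPrefix, List.range_succ]
  have h4 : ∀ n, wordPrefix w (4 * (n + 1)) = wordPrefix w (4 * n) ++
      [w (4 * n), w (4 * n + 1), w (4 * n + 2), w (4 * n + 3)] := by
    intro n
    rw [show 4 * (n + 1) = 4 * n + 1 + 1 + 1 + 1 by ring, hs, hs, hs, hs]
    simp
  unfold IsFixedPoint
  simp only [hlen]
  constructor
  · intro h n
    have h1 := h (n + 1)
    rw [hs, List.flatMap_append, h n, h4] at h1
    simpa using List.append_cancel_left h1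
  · intro h n
    induction n with
    | zero => rfl
    | succ n ih =>
      rw [hs, List.flatMap_append, ih, h4, ← h n]
      simp

/-- The letters of the fixed point that starts with `x1`. -/
def fixedWord (n : ℕ) : Letter :=
  if n = 0 then Letter.x1 else (φ (fixedWord (n / 4))).getD (n % 4) Letter.x1
termination_by n
decreasing_by omega

/-- There is exactly one right-infinite word that starts with `x1` and is fixed by the morphism. -/
theorem existsUnique_isFixedPoint :
    ∃! w : ℕ → Letter, w 0 = Letter.x1 ∧ IsFixedPoint φ w := by
  have h0 : fixedWord 0 = Letter.x1 := by
    rw [fixedWord]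
    simp
  have hstep : ∀ n j, j < 4 → fixedWord (4 * n + j) = (φ (fixedWord n)).getD j Letter.x1 := by
    intro n j hj
    by_cases hz : 4 * n + j = 0
    · obtain rfl : n = 0 := by omega
      obtain rfl : j = 0 := by omega
      simp [h0, φ]
    · rw [fixedWord, if_neg hz, show (4 * n + j) / 4 = n by omega,
        show (4 * n + j) % 4 = j by omega]
  refine ⟨fixedWord, ⟨h0, ?_⟩, ?_⟩
  · rw [isFixedPoint_φ_iff]
    intro n
    have e0 := hstep n 0 (by norm_num)
    rw [Nat.add_zero] at e0
    rw [e0, hstep n 1 (by norm_num), hstep n 2 (by norm_num), hstep n 3 (by norm_num)]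
    cases fixedWord n <;> rfl
  · rintro v ⟨hv0, hv⟩
    rw [isFixedPoint_φ_iff] at hv
    funext n
    induction n using Nat.strong_induction_on with
    | _ n ih =>
      by_cases hz : n = 0
      · subst hz
        rw [hv0, h0]
      · have hq := ih (n / 4) (by omega)
        have hn : n = 4 * (n / 4) + n % 4 := by omega
        have hr : n % 4 < 4 := Nat.mod_lt _ (by norm_num)
        have key : v (4 * (n / 4) + n % 4) = (φ (v (n / 4))).getD (n % 4) Letter.x1 := by
          rw [hv]
          generalize n % 4 = r at hr
          interval_cases r <;> rfl
        rw [hn, hstep _ _ hr, key, hq]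

/-! ### The monomial algebra of an infinite word, with a grading given by degrees of letters -/

section Algebra

variable (k : Type*) [Field k] {X : Type*}

/-- The monomial of the free algebra `k{X}` given by a finite word. -/
def freeMonomial (u : List X) : FreeAlgebra k X :=
  (u.map (FreeAlgebra.ι k)).prod

/-- The relations `u = 0`, for the finite words `u` that are not subwords of `w`. -/
def IsRelation (w : ℕ → X) (a b : FreeAlgebra k X) : Prop :=
  (∃ u : List X, ¬ IsSubword u w ∧ a = freeMonomial k u) ∧ b = 0

/-- The algebra `A_w`: the quotient of the free algebra `k{X}` by the two-sided ideal generated by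
all finite words that are not subwords of `w`. -/
abbrev IterativeAlgebra (w : ℕ → X) : Type _ :=
  RingQuot (IsRelation k w)

/-- The image in `A_w` of a finite word. -/
def monomial (w : ℕ → X) (u : List X) : IterativeAlgebra k w :=
  RingQuot.mkAlgHom k (IsRelation k w) (freeMonomial k u)

theorem monomial_append (w : ℕ → X) (u v : List X) :
    monomial k w (u ++ v) = monomial k w u * monomial k w v := by
  simp [monomial, freeMonomial]

/-- The component of degree `d` of `A_w`, when the letter `a` is given degree `deg a`: it is
spanned by the words of total degree `d`. -/
def gradedPiece (w : ℕ → X) (deg : X → ℕ) (d : ℕ) : Submodule k (IterativeAlgebra k w) :=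
  Submodule.span k {a | ∃ u : List X, (u.map deg).sum = d ∧ a = monomial k w u}

theorem gradedPiece_mul_mem (w : ℕ → X) (deg : X → ℕ) (d e : ℕ) {a b : IterativeAlgebra k w}
    (ha : a ∈ gradedPiece k w deg d) (hb : b ∈ gradedPiece k w deg e) :
    a * b ∈ gradedPiece k w deg (d + e) := by
  have h : gradedPiece k w deg d * gradedPiece k w deg e ≤ gradedPiece k w deg (d + e) := by
    rw [gradedPiece, gradedPiece, Submodule.span_mul_span, Submodule.span_le]
    rintro _ ⟨_, ⟨u, hu, rfl⟩, _, ⟨v, hv, rfl⟩, rfl⟩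
    exact Submodule.subset_span ⟨u ++ v, by simp [hu, hv], (monomial_append k w u v).symm⟩
  exact h (Submodule.mul_mem_mul ha hb)

/-- The positive part of `A_w`: the sum of all its components of positive degree. It is an algebra
without unit. -/
def positivePart (w : ℕ → X) (deg : X → ℕ) : NonUnitalSubalgebra k (IterativeAlgebra k w) :=
  { (⨆ d : ℕ, gradedPiece k w deg (d + 1) : Submodule k (IterativeAlgebra k w)) with
    mul_mem' := by
      intro a b ha hb
      have h : (⨆ d : ℕ, gradedPiece k w deg (d + 1)) * (⨆ d : ℕ, gradedPiece k w deg (d + 1)) ≤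
          ⨆ d : ℕ, gradedPiece k w deg (d + 1) := by
        rw [Submodule.iSup_mul, iSup_le_iff]
        intro i
        rw [Submodule.mul_iSup, iSup_le_iff]
        intro j
        rw [Submodule.mul_le]
        intro m hm n hn
        refine Submodule.mem_iSup_of_mem (i + 1 + j) ?_
        exact gradedPiece_mul_mem k w deg (i + 1) (j + 1) hm hn
      exact h (Submodule.mul_mem_mul ha hb) }

/-- The component of degree `d` of the positive part of `A_w`. -/
def positivePiece (w : ℕ → X) (deg : X → ℕ) (d : ℕ) : Submodule k (positivePart k w deg) :=
  (gradedPiece k w deg d).comap (NonUnitalSubalgebra.toSubmodule (positivePart k w deg)).subtype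

end Algebra

/-! ### Properties of associative algebras that need not have a unit -/

section Ring

variable {R : Type*} [NonUnitalRing R]

/-- `setPow S n` is the set `S ^ (n + 1)` of all products of `n + 1` elements of `S`. -/
def setPow (S : Set R) : ℕ → Set R
  | 0 => S
  | n + 1 => setPow S n * S

/-- `S ^ N = (0)` for some `N ≥ 1`. -/
def IsNilpotentSet (S : Set R) : Prop :=
  ∃ n : ℕ, setPow S n ⊆ {0}

variable (R)

/-- A prime ring: it is nonzero, and the product of two nonzero two-sided ideals is nonzero. -/
def IsPrimeRing : Prop :=
  Nontrivial R ∧ ∀ I J : TwoSidedIdeal R, (∀ a ∈ I, ∀ b ∈ J, a * b = 0) → I = ⊥ ∨ J = ⊥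

/-- The Jacobson radical of a ring without unit: the largest two-sided ideal all of whose elements
are quasi-regular. -/
def jacobsonRadical : TwoSidedIdeal R :=
  sSup {I | ∀ a ∈ I, IsQuasiregular a}

end Ring

section NonUnitalAlgebra

variable (k : Type*) [Field k] (R : Type*) [NonUnitalRing R] [Module k R]

/-- An algebra is just infinite if it is infinite-dimensional, but its quotient by each nonzero
two-sided ideal is finite-dimensional. -/
def IsJustInfinite : Prop :=
  ¬ Module.Finite k R ∧
    ∀ I : Submodule k R, (∀ r : R, ∀ a ∈ I, r * a ∈ I ∧ a * r ∈ I) → I ≠ ⊥ →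
      Module.Finite k (R ⧸ I)

/-- An algebra is finitely generated as a Lie algebra if some finite subset generates it under
linear combinations and the commutator bracket `a * b - b * a`. -/
def IsFinitelyGeneratedLie : Prop :=
  ∃ S : Set R, S.Finite ∧ ∀ L : Submodule k R, S ⊆ L →
    (∀ a ∈ L, ∀ b ∈ L, a * b - b * a ∈ L) → L = ⊤

/-- The family `𝒜` is a grading of the algebra `R`, and every set of homogeneous elements of the
same degree is nilpotent. -/
structure IsGradedNilpotent (𝒜 : ℕ → Submodule k R) : Prop where
  isInternal : DirectSum.IsInternal 𝒜
  mul_mem : ∀ i j : ℕ, ∀ a ∈ 𝒜 i, ∀ b ∈ 𝒜 j, a * b ∈ 𝒜 (i + j)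
  isNilpotentSet : ∀ (d : ℕ) (S : Set R), S ⊆ 𝒜 d → IsNilpotentSet S

variable {k R}

/-- The dimension of `V + V ^ 2 + ⋯ + V ^ n`. -/
noncomputable def growth (V : Submodule k R) (n : ℕ) : ℕ :=
  Module.finrank k (Submodule.span k (⋃ i < n, setPow (V : Set R) i))

variable (k R) [IsScalarTower k R R] [SMulCommClass k R R]

/-- `V` is a finite-dimensional subspace that generates `R` as an algebra (without unit). -/
def IsGeneratingSubspace (V : Submodule k R) : Prop :=
  Module.Finite k V ∧ NonUnitalAlgebra.adjoin k (V : Set R) = ⊤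

/-- A finitely generated algebra. -/
def IsFinitelyGenerated : Prop :=
  ∃ V : Submodule k R, IsGeneratingSubspace k R V

/-- Quadratic growth: the algebra is finitely generated, and `dim (V + ⋯ + V ^ n) = Θ(n ^ 2)` for
its finite-dimensional generating subspaces `V`. -/
def HasQuadraticGrowth : Prop :=
  IsFinitelyGenerated k R ∧ ∀ V : Submodule k R, IsGeneratingSubspace k R V →
    (fun n : ℕ => (growth V n : ℝ)) =Θ[Filter.atTop] fun n : ℕ => (n : ℝ) ^ 2

/-- The algebra is finitely generated, of Gelfand-Kirillov dimension `g`: the upper limit of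
`log dim (V + ⋯ + V ^ n) / log n` is `g` for its finite-dimensional generating subspaces `V`. -/
def HasGKDim (g : EReal) : Prop :=
  IsFinitelyGenerated k R ∧ ∀ V : Submodule k R, IsGeneratingSubspace k R V →
    Filter.limsup (fun n : ℕ => ((Real.log (growth V n) / Real.log n : ℝ) : EReal))
      Filter.atTop = g

end NonUnitalAlgebra

end Iterative

/-!
The word `w` is the fixed point of a `4`-uniform morphism of a rigid shape: each image `φ a`
consists of two `x`-letters with increasing indices followed by two distinct `y`-letters, and
either of these two halves determines `a`. Hence two consecutive letters determine their position
modulo four, and a window of length `2 * 4 ^ m` determines its position modulo `4 ^ m`. So the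
morphism can be undone (`IsFixedPoint.modEq_of_agree`), and a word of bounded length is determined
by its sufficiently long contexts on both sides (`IsFixedPoint.exists_context_of_le`). Moreover
`w` is uniformly recurrent.

The algebra `A_w` acts on sequences of scalars: a word `u` shifts by its length and erases the
entries at the positions at which `u` does not occur. So the subwords of `w` are a basis. What is
needed of the positive part is collected in `IsWordAlgebra`, and the ring-theoretic properties are
derived from it as follows.

* Multiplying a nonzero element on both sides by long contexts of one of its words leaves only one
  word (`IsWordAlgebra.exists_mul_mul_eq_map`). By uniform recurrence a nonzero ideal contains all
  long words. Hence the algebra is just infinite and prime.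
* The sum of all words of length `K` acts as the `K`-th power of the shift, and is not
  quasi-regular. It lies in any given nonzero ideal if `K` is large, so that the Jacobson radical
  is zero.
* A word of length at least three can be cut as `a ++ b` such that `b ++ a` is not a subword
  (`IsFixedPoint.exists_append_not_isSubword`), and is then the bracket of `a` and `b`. The reason
  is that a cyclic word all of whose rotations are subwords could be desubstituted down to length
  one or two. So the words of length at most two generate the Lie algebra.
* A nonzero product of many words of degree `d` would make the degrees of prefixes of `w` run
  through a long arithmetic progression of difference `d`. But each letter of degree two makes
  these degrees skip a value, and in a long window all residues modulo `d` are skipped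
  (`IsFixedPoint.exists_unskipped_eq_empty`). Indeed, a minimal set of residues that are not
  skipped is invariant under translation by the degrees of `φ ^ m a` for all letters `a` and a
  large `m`, and these degrees have no common prime divisor (`exists_not_dvd_iterDegree`).
* By synchronization, the number of subwords of length at most `n` is bounded below by a multiple
  of `n ^ 2`. It is bounded above by such a multiple because a word of length at most `4 ^ m` lies
  in the image under `φ ^ m` of two consecutive letters.
-/

namespace Iterative

/-! ### Letters and classes -/

instance : Fintype Letter where
  elems := {.x1, .x2, .x3, .x4, .x5, .x6, .y1, .y2, .y3, .y4, .y5, .y6}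
  complete a := by cases a <;> decide

/-- Whether a letter is one of `x1, …, x6`. -/
def isX : Letter → Bool
  | .x1 | .x2 | .x3 | .x4 | .x5 | .x6 => true
  | _ => false

/-- The `j`-th letter of `φ a`, for `j < 4` (and the junk value `x1` for larger `j`). -/
def image (a : Letter) (j : ℕ) : Letter :=
  (φ a).getD j .x1

theorem isX_image (a : Letter) {j : ℕ} (hj : j < 4) : isX (image a j) = decide (j < 2) := by
  interval_cases j <;> revert a <;> decide

theorem eq_of_image_left {a b : Letter} (h0 : image a 0 = image b 0)
    (h1 : image a 1 = image b 1) : a = b := by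
  revert a b; decide

theorem eq_of_image_right {a b : Letter} (h2 : image a 2 = image b 2)
    (h3 : image a 3 = image b 3) : a = b := by
  revert a b; decide

theorem image_zero_ne_image_one (a : Letter) : image a 0 ≠ image a 1 := by
  revert a; decide

theorem image_two_ne_image_three (a : Letter) : image a 2 ≠ image a 3 := by
  revert a; decide

theorem exists_image_image_eq_x1 (a : Letter) :
    ∃ i < 4, ∃ j < 4, image (image a i) j = .x1 := by
  revert a; decide

/-! ### Synchronization -/

section Word

variable {w : ℕ → Letter}

theorem IsFixedPoint.apply_four_mul_add (hw : IsFixedPoint φ w) (n : ℕ) {j : ℕ} (hj : j < 4) :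
    w (4 * n + j) = image (w n) j := by
  rw [image, (isFixedPoint_φ_iff w).1 hw n]
  interval_cases j <;> rfl

theorem IsFixedPoint.isX_apply (hw : IsFixedPoint φ w) (n : ℕ) :
    isX (w n) = decide (n % 4 < 2) := by
  have hr : n % 4 < 4 := Nat.mod_lt _ (by norm_num)
  conv_lhs => rw [← Nat.div_add_mod n 4, hw.apply_four_mul_add _ hr, isX_image _ hr]

/-- Two consecutive letters determine their position modulo four. -/
theorem IsFixedPoint.mod_four_eq (hw : IsFixedPoint φ w) {i j : ℕ} (h0 : w i = w j)
    (h1 : w (i + 1) = w (j + 1)) : i % 4 = j % 4 := by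
  have e0 := hw.isX_apply i
  have e1 := hw.isX_apply (i + 1)
  rw [h0, hw.isX_apply] at e0
  rw [h1, hw.isX_apply] at e1
  rw [decide_eq_decide] at e0 e1
  omega

theorem IsFixedPoint.eq_of_left_half (hw : IsFixedPoint φ w) {i j : ℕ}
    (h0 : w (4 * i) = w (4 * j)) (h1 : w (4 * i + 1) = w (4 * j + 1)) : w i = w j := by
  rw [← Nat.add_zero (4 * i), ← Nat.add_zero (4 * j), hw.apply_four_mul_add _ (by norm_num),
    hw.apply_four_mul_add _ (by norm_num)] at h0
  rw [hw.apply_four_mul_add _ (by norm_num), hw.apply_four_mul_add _ (by norm_num)] at h1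
  exact eq_of_image_left h0 h1

theorem IsFixedPoint.eq_of_right_half (hw : IsFixedPoint φ w) {i j : ℕ}
    (h2 : w (4 * i + 2) = w (4 * j + 2)) (h3 : w (4 * i + 3) = w (4 * j + 3)) : w i = w j := by
  rw [hw.apply_four_mul_add _ (by norm_num), hw.apply_four_mul_add _ (by norm_num)] at h2 h3
  exact eq_of_image_right h2 h3

theorem IsFixedPoint.apply_ne_succ (hw : IsFixedPoint φ w) (n : ℕ) : w n ≠ w (n + 1) := by
  intro h
  have e0 := hw.isX_apply n
  rw [h, hw.isX_apply, decide_eq_decide] at e0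
  have hn : n % 4 = 0 ∨ n % 4 = 2 := by omega
  rw [← Nat.div_add_mod n 4] at h
  rcases hn with hn | hn <;> rw [hn, add_assoc, hw.apply_four_mul_add _ (by norm_num),
    hw.apply_four_mul_add _ (by norm_num)] at h
  · exact image_zero_ne_image_one _ h
  · exact image_two_ne_image_three _ h

theorem IsFixedPoint.isX_apply_add_two (hw : IsFixedPoint φ w) (n : ℕ) :
    isX (w (n + 2)) = !isX (w n) := by
  rw [hw.isX_apply, hw.isX_apply, ← decide_not, decide_eq_decide]
  omega

/-- A window of length `2 * 4 ^ m` determines its position modulo `4 ^ m`. -/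
theorem IsFixedPoint.modEq_of_agree (hw : IsFixedPoint φ w) (m : ℕ) :
    ∀ i j : ℕ, (∀ t < 2 * 4 ^ m, w (i + t) = w (j + t)) → i ≡ j [MOD 4 ^ m] := by
  induction m with
  | zero => intro i j _; rw [pow_zero]; exact Nat.modEq_one
  | succ m ih =>
    intro i j h
    have hpos : 0 < 4 ^ m := by positivity
    rw [pow_succ] at h
    have hmod : i % 4 = j % 4 := hw.mod_four_eq (h 0 (by omega)) (h 1 (by omega))
    obtain ⟨a, b, r, hr, rfl, rfl⟩ : ∃ a b r, r < 4 ∧ i = 4 * a + r ∧ j = 4 * b + r :=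
      ⟨i / 4, j / 4, i % 4, Nat.mod_lt _ (by norm_num), by omega, by omega⟩
    have cell_left : ∀ s, r ≤ 4 * s → 4 * s + 2 ≤ r + 2 * (4 ^ m * 4) → w (a + s) = w (b + s) := by
      intro s h1 h2
      have e0 := h (4 * s - r) (by omega)
      have e1 := h (4 * s + 1 - r) (by omega)
      apply hw.eq_of_left_half
      · convert e0 using 2 <;> omega
      · convert e1 using 2 <;> omega
    have cell_right : ∀ s, r ≤ 4 * s + 2 → 4 * s + 4 ≤ r + 2 * (4 ^ m * 4) →
        w (a + s) = w (b + s) := by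
      intro s h1 h2
      have e0 := h (4 * s + 2 - r) (by omega)
      have e1 := h (4 * s + 3 - r) (by omega)
      apply hw.eq_of_right_half
      · convert e0 using 2 <;> omega
      · convert e1 using 2 <;> omega
    have key : a ≡ b [MOD 4 ^ m] := by
      by_cases hr3 : r = 3
      · refine Nat.ModEq.add_right_cancel' 1 (ih _ _ fun t ht => ?_)
        rw [add_assoc, add_assoc]
        exact cell_left _ (by omega) (by omega)
      · refine ih _ _ fun t ht => ?_
        exact cell_right _ (by omega) (by omega)
    rw [pow_succ, mul_comm]
    exact (key.mul_left' 4).add_right r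

/-- A short block is determined by sufficiently long contexts on both of its sides. -/
theorem IsFixedPoint.exists_context (hw : IsFixedPoint φ w) (L : ℕ) :
    ∃ K, ∀ p q : ℕ, K ≤ p → K ≤ q → (∀ t < K, w (p - K + t) = w (q - K + t)) →
      (∀ t < K, w (p + L + t) = w (q + L + t)) → ∀ t < L, w (p + t) = w (q + t) := by
  induction L using Nat.strong_induction_on with
  | _ L ih =>
  rcases Nat.eq_zero_or_pos L with rfl | hL
  · exact ⟨0, fun _ _ _ _ _ _ t ht => absurd ht (Nat.not_lt_zero t)⟩
  obtain ⟨K, hK⟩ := ih ((L + 2) / 4) (by omega)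
  refine ⟨4 * K + 12, fun p q hp hq hl hr => ?_⟩
  have hmod : p % 4 = q % 4 := by
    have e0 := hl (4 * K + 10) (by omega)
    have e1 := hl (4 * K + 11) (by omega)
    have := hw.mod_four_eq e0 e1
    omega
  -- Only the cells `a, …, a + (L + 2) / 4 - 1` may have no half inside the contexts.
  obtain ⟨a, b, r, hr2, ha, hb⟩ :
      ∃ a b r, r < 4 ∧ p + 2 = 4 * a + r ∧ q + 2 = 4 * b + r :=
    ⟨(p + 2) / 4, (q + 2) / 4, (p + 2) % 4, Nat.mod_lt _ (by norm_num), by omega, by omega⟩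
  have left : ∀ s, s < K + 1 → w (a - 1 - s) = w (b - 1 - s) := by
    intro s hs
    have e0 := hl (4 * (a - 1 - s) - (p - (4 * K + 12))) (by omega)
    have e1 := hl (4 * (a - 1 - s) + 1 - (p - (4 * K + 12))) (by omega)
    apply hw.eq_of_left_half
    · convert e0 using 2 <;> omega
    · convert e1 using 2 <;> omega
  have right : ∀ s, s < K + 1 → w (a + (L + 2) / 4 + s) = w (b + (L + 2) / 4 + s) := by
    intro s hs
    have e0 := hr (4 * (a + (L + 2) / 4 + s) + 2 - (p + L)) (by omega)
    have e1 := hr (4 * (a + (L + 2) / 4 + s) + 3 - (p + L)) (by omega)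
    apply hw.eq_of_right_half
    · convert e0 using 2 <;> omega
    · convert e1 using 2 <;> omega
  have middle := hK a b (by omega) (by omega)
    (fun t ht => by
      convert left (K - 1 - t) (by omega) using 2 <;> omega)
    (fun t ht => right t (by omega))
  intro t ht
  have hcell : w ((p + t) / 4) = w ((q + t) / 4) := by
    rcases Nat.lt_or_ge ((p + t) / 4) a with h1 | h1
    · convert left 0 (by omega) using 2 <;> omega
    rcases Nat.lt_or_ge ((p + t) / 4) (a + (L + 2) / 4) with h2 | h2
    · convert middle ((p + t) / 4 - a) (by omega) using 2 <;> omega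
    · convert right 0 (by omega) using 2 <;> omega
  have hlt : (p + t) % 4 < 4 := Nat.mod_lt _ (by norm_num)
  rw [← Nat.div_add_mod (p + t) 4, hw.apply_four_mul_add _ hlt, hcell,
    ← hw.apply_four_mul_add _ hlt]
  congr 1
  omega

/-- Two blocks of bounded length, not necessarily of the same length, that share sufficiently long
contexts on both sides are equal. -/
theorem IsFixedPoint.exists_context_of_le (hw : IsFixedPoint φ w) (B : ℕ) :
    ∃ K, ∀ p q L M : ℕ, L ≤ B → M ≤ B → K ≤ p → K ≤ q →
      (∀ t < K, w (p - K + t) = w (q - K + t)) →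
      (∀ t < K, w (p + L + t) = w (q + M + t)) → L = M ∧ ∀ t < L, w (p + t) = w (q + t) := by
  obtain ⟨K, hK⟩ := hw.exists_context B
  have hB : B < 4 ^ B := Nat.lt_pow_self (by norm_num)
  refine ⟨K + B + 2 * 4 ^ B, fun p q L M hL hM hp hq hl hr => ?_⟩
  have hLM : L = M := by
    have e0 := hw.modEq_of_agree B _ _ fun t ht => hl t (by omega)
    have e1 := hw.modEq_of_agree B _ _ fun t ht => hr t (by omega)
    have e2 := e0.add_right (K + B + 2 * 4 ^ B)
    rw [Nat.sub_add_cancel hp, Nat.sub_add_cancel hq] at e2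
    exact Nat.ModEq.eq_of_lt_of_lt (Nat.ModEq.add_left_cancel e2 e1) (by omega) (by omega)
  subst hLM
  refine ⟨rfl, fun t ht => hK p q (by omega) (by omega) (fun t ht => ?_) (fun t ht => ?_) t
    (by omega)⟩
  · convert hl (B + 2 * 4 ^ B + t) (by omega) using 2 <;> omega
  · convert hr (B - L + t) (by omega) using 2 <;> omega

/-! ### Uniform recurrence -/

/-- The letter at position `n` determines the block of `w` of length `4 ^ m` at `4 ^ m * n`. -/
theorem IsFixedPoint.apply_pow_mul_add (hw : IsFixedPoint φ w) (m : ℕ) :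
    ∀ {n n' : ℕ}, w n = w n' → ∀ t < 4 ^ m, w (4 ^ m * n + t) = w (4 ^ m * n' + t) := by
  induction m with
  | zero =>
    intro n n' h t ht
    obtain rfl : t = 0 := by simpa using ht
    simpa using h
  | succ m ih =>
    intro n n' h t ht
    have hr : t / 4 ^ m < 4 := Nat.div_lt_of_lt_mul (by rwa [pow_succ] at ht)
    have hpos : 0 < 4 ^ m := by positivity
    have e := ih (n := 4 * n + t / 4 ^ m) (n' := 4 * n' + t / 4 ^ m)
      (by rw [hw.apply_four_mul_add _ hr, hw.apply_four_mul_add _ hr, h]) (t % 4 ^ m)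
      (Nat.mod_lt _ hpos)
    have hsplit : ∀ a : ℕ, 4 ^ (m + 1) * a + t = 4 ^ m * (4 * a + t / 4 ^ m) + t % 4 ^ m := by
      intro a
      conv_lhs => rw [← Nat.div_add_mod t (4 ^ m)]
      ring
    rw [hsplit, hsplit, e]

theorem IsFixedPoint.exists_apply_eq_x1 (hw : IsFixedPoint φ w) (i : ℕ) :
    ∃ t < 32, w (i + t) = .x1 := by
  obtain ⟨a, ha, b, hb, h⟩ := exists_image_image_eq_x1 (w (i / 16 + 1))
  refine ⟨4 * (4 * (i / 16 + 1) + a) + b - i, by omega, ?_⟩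
  rw [← h, ← hw.apply_four_mul_add _ ha, ← hw.apply_four_mul_add _ hb]
  congr 1
  omega

/-- Every prefix of `w` occurs in `w` with bounded gaps. -/
theorem IsFixedPoint.exists_recurrence (hw : IsFixedPoint φ w) (hw0 : w 0 = .x1) (P : ℕ) :
    ∃ K, ∀ i, ∃ s < K, ∀ t < P, w (i + s + t) = w t := by
  have hP : P < 4 ^ P := Nat.lt_pow_self (by norm_num)
  refine ⟨4 ^ P * 33, fun i => ?_⟩
  obtain ⟨t, ht, h⟩ := hw.exists_apply_eq_x1 (i / 4 ^ P + 1)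
  have hi := Nat.div_add_mod i (4 ^ P)
  have hlt := Nat.mod_lt i (show 4 ^ P > 0 by positivity)
  have hmul : 4 ^ P * (i / 4 ^ P + 1 + t) = 4 ^ P * (i / 4 ^ P) + 4 ^ P + 4 ^ P * t := by ring
  have hmt : 4 ^ P * t ≤ 4 ^ P * 31 := Nat.mul_le_mul_left _ (by omega)
  refine ⟨4 ^ P * (i / 4 ^ P + 1 + t) - i, by omega, fun u hu => ?_⟩
  have e := hw.apply_pow_mul_add P (h.trans hw0.symm) u (by omega)
  rw [Nat.mul_zero, Nat.zero_add] at e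
  rw [← e]
  congr 1
  omega

/-! ### Cyclic words -/

/-- A purely periodic sequence of period `n ≥ 3` whose windows of length `n` all occur in `w` has a
period that is a multiple of four, and it is the image under `φ` of a sequence of period `n / 4`,
even whose windows of length `n / 4 + 1` occur in `w`. -/
theorem IsFixedPoint.exists_cyclic_desubstitution (hw : IsFixedPoint φ w) {n : ℕ} (hn : 3 ≤ n)
    {c : ℕ → Letter} (hc : ∀ s, c (s + n) = c s)
    (h : ∀ r, ∃ i, ∀ t < n, c (r + t) = w (i + t)) :
    ∃ k, n = 4 * k ∧ ∃ c' : ℕ → Letter, (∀ s, c' (s + k) = c' s) ∧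
      ∀ r, ∃ i, ∀ t < k + 1, c' (r + t) = w (i + t) := by
  choose pos hpos using h
  have h2 : ∀ s, isX (c (s + 2)) = !isX (c s) := by
    intro s
    rw [hpos s 2 (by omega), hw.isX_apply_add_two, ← Nat.add_zero s, hpos (s + 0) 0 (by omega)]
    rfl
  have hodd : ∀ j s, isX (c (s + 2 * (2 * j + 1))) = !isX (c s) := by
    intro j
    induction j with
    | zero => exact h2
    | succ j ih =>
      intro s
      rw [show s + 2 * (2 * (j + 1) + 1) = s + 2 * (2 * j + 1) + 2 + 2 by ring, h2, h2, ih,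
        Bool.not_not]
  have h4 : n % 4 = 0 := by
    by_contra hne
    rcases Nat.even_or_odd n with ⟨j, hj⟩ | ⟨j, hj⟩
    · have e := hodd (j / 2) 0
      rw [show 0 + 2 * (2 * (j / 2) + 1) = 0 + n by omega, hc] at e
      simp at e
    · have e := hodd j 0
      rw [show 0 + 2 * (2 * j + 1) = 0 + n + n by omega, hc, hc] at e
      simp at e
  obtain ⟨k, rfl⟩ : ∃ k, n = 4 * k := ⟨n / 4, by omega⟩
  refine ⟨k, rfl, ?_⟩
  have hphase : ∀ s, isX (c s) = decide ((pos 0 + s) % 4 < 2) := by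
    intro s
    induction s using Nat.strong_induction_on with
    | _ s ih =>
      by_cases hs : s < 2
      · have e := hpos 0 s (by omega)
        rw [Nat.zero_add] at e
        rw [e, hw.isX_apply]
      · have e := h2 (s - 2)
        rw [Nat.sub_add_cancel (by omega), ih (s - 2) (by omega)] at e
        rw [e, ← decide_not, decide_eq_decide]
        omega
  have hmod : ∀ r, pos r % 4 = (pos 0 + r) % 4 := by
    intro r
    have e0 := hphase r
    have e1 := hphase (r + 1)
    rw [← Nat.add_zero r, hpos _ 0 (by omega), hw.isX_apply, decide_eq_decide] at e0
    rw [hpos _ 1 (by omega), hw.isX_apply, decide_eq_decide] at e1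
    simp only [Nat.add_zero] at e0
    omega
  -- `o` is a position at which the sequence can be cut into images of letters.
  obtain ⟨o, ho⟩ : ∃ o, (pos 0 + o) % 4 = 0 := ⟨4 - pos 0 % 4, by omega⟩
  have hcell : ∀ s, ∃ j, pos (o + 4 * s) = 4 * j := by
    intro s
    have := hmod (o + 4 * s)
    exact ⟨pos (o + 4 * s) / 4, by omega⟩
  choose cell hcell using hcell
  have himg : ∀ s t, t < 4 → c (o + 4 * s + t) = image (w (cell s)) t := by
    intro s t ht
    rw [hpos _ t (by omega), hcell, hw.apply_four_mul_add _ ht]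
  have hper : ∀ s, w (cell (s + k)) = w (cell s) := by
    intro s
    have e : ∀ t < 4, image (w (cell (s + k))) t = image (w (cell s)) t := by
      intro t ht
      rw [← himg _ _ ht, ← himg _ _ ht, ← hc (o + 4 * s + t)]
      congr 1
      ring
    exact eq_of_image_left (e 0 (by norm_num)) (e 1 (by norm_num))
  refine ⟨fun s => w (cell s), hper, fun r => ?_⟩
  -- The window that starts in the middle of a cell sees both halves of that cell.
  obtain ⟨j, hj⟩ : ∃ j, pos (o + 4 * r + 2) = 4 * j + 2 := by
    have := hmod (o + 4 * r + 2)
    exact ⟨pos (o + 4 * r + 2) / 4, by omega⟩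
  have hwin : ∀ t, t < 4 * k → c (o + 4 * r + 2 + t) = w (4 * j + 2 + t) := by
    intro t ht
    rw [hpos _ t ht, hj]
  have hwin' : ∀ s t, t < 4 → 2 ≤ 4 * s + t → 4 * s + t < 4 * k + 2 →
      image (w (cell (r + s))) t = image (w (j + s)) t := by
    intro s t ht h1 h2
    rw [← himg _ _ ht, ← hw.apply_four_mul_add _ ht]
    convert hwin (4 * s + t - 2) (by omega) using 2 <;> omega
  refine ⟨j, fun t ht => ?_⟩
  rcases Nat.eq_zero_or_pos t with rfl | htpos
  · exact eq_of_image_right (hwin' 0 2 (by omega) (by omega) (by omega))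
      (hwin' 0 3 (by omega) (by omega) (by omega))
  · exact eq_of_image_left (hwin' t 0 (by omega) (by omega) (by omega))
      (hwin' t 1 (by omega) (by omega) (by omega))

/-- No purely periodic sequence of period `n ≥ 1` has all its windows of length `n + 1` in `w`. -/
theorem IsFixedPoint.not_cyclic (hw : IsFixedPoint φ w) (n : ℕ) (hn : 1 ≤ n) (c : ℕ → Letter)
    (hc : ∀ s, c (s + n) = c s) (h : ∀ r, ∃ i, ∀ t < n + 1, c (r + t) = w (i + t)) : False := by
  induction n using Nat.strong_induction_on generalizing c with
  | _ n ih =>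
  obtain ⟨i, hi⟩ := h 0
  have heq : w i = w (i + n) := by
    have e0 := hi 0 (by omega)
    have en := hi n (by omega)
    rw [hc] at en
    exact e0.symm.trans en
  rcases (by omega : n = 1 ∨ n = 2 ∨ 3 ≤ n) with rfl | rfl | hn3
  · exact hw.apply_ne_succ i heq
  · have e := hw.isX_apply_add_two i
    rw [← heq] at e
    simp at e
  · obtain ⟨k, rfl, c', hc', h'⟩ := hw.exists_cyclic_desubstitution hn3 hc fun r =>
      (h r).imp fun i hi t ht => hi t (by omega)
    exact ih k (by omega) (by omega) c' hc' h'

theorem isSubword_iff {X : Type*} {u : List X} {w : ℕ → X} :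
    IsSubword u w ↔ ∃ i, ∀ (t : ℕ) (ht : t < u.length), u[t] = w (i + t) := by
  refine exists_congr fun i => ⟨fun h t ht => ?_, fun h => ?_⟩
  · conv_lhs => rw [List.getElem_of_eq h]
    simp
  · apply List.ext_getElem
    · simp
    · intro t h1 h2
      simp [h t h1]

/-- Every word of length at least three can be cut into two parts so that the two parts in the
reverse order do not form a subword of `w`. -/
theorem IsFixedPoint.exists_append_not_isSubword (hw : IsFixedPoint φ w) {u : List Letter}
    (hu : 3 ≤ u.length) (hsub : IsSubword u w) :
    ∃ a b : List Letter, a ≠ [] ∧ b ≠ [] ∧ u = a ++ b ∧ ¬ IsSubword (b ++ a) w := by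
  by_contra hcon
  push Not at hcon
  have hrot : ∀ r ≤ u.length, IsSubword (u.drop r ++ u.take r) w := by
    intro r hr
    by_cases h0 : r = 0
    · simpa [h0] using hsub
    by_cases h1 : r = u.length
    · simpa [h1] using hsub
    refine hcon _ _ ?_ ?_ (List.take_append_drop r u).symm
    · rw [← List.length_pos_iff, List.length_take]; omega
    · rw [← List.length_pos_iff, List.length_drop]; omega
  have hpos : 0 < u.length := by omega
  let c : ℕ → Letter := fun s => u[s % u.length]'(Nat.mod_lt _ hpos)
  have hc : ∀ s, c (s + u.length) = c s := fun s => by simp [c]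
  obtain ⟨k, hk, c', hc', h'⟩ := hw.exists_cyclic_desubstitution hu hc fun r => by
    obtain ⟨i, hi⟩ := isSubword_iff.1 (hrot (r % u.length) (Nat.mod_lt _ hpos).le)
    refine ⟨i, fun t ht => ?_⟩
    rw [← hi t (by simp; omega)]
    have hr := Nat.mod_lt r hpos
    rcases Nat.lt_or_ge (r % u.length + t) u.length with h1 | h1
    · rw [List.getElem_append_left (by simp; omega), List.getElem_drop]
      simp only [c]
      congr 1
      rw [Nat.add_mod, Nat.mod_eq_of_lt ht, Nat.mod_eq_of_lt h1]
    · rw [List.getElem_append_right (by simp; omega), List.getElem_take]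
      simp only [c, List.length_drop]
      congr 1
      rw [Nat.add_mod, Nat.mod_eq_of_lt ht, Nat.mod_eq_sub_mod h1, Nat.mod_eq_of_lt (by omega)]
      omega
  exact hw.not_cyclic k (by omega) c' hc' h'

end Word

/-! ### Degrees of iterated images of letters -/

/-- The degree of `φ ^ m` applied to the letter `a`. -/
def iterDegree : ℕ → Letter → ℤ
  | 0, a => letterDegree a
  | m + 1, a => iterDegree m (image a 0) + iterDegree m (image a 1) + iterDegree m (image a 2) +
      iterDegree m (image a 3)

/-- The integer-valued function on the letters `x1, …, x6, y1, …, y6` with the given values. -/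
def letterVec (a₁ a₂ a₃ a₄ a₅ a₆ b₁ b₂ b₃ b₄ b₅ b₆ : ℤ) : Letter → ℤ
  | .x1 => a₁ | .x2 => a₂ | .x3 => a₃ | .x4 => a₄ | .x5 => a₅ | .x6 => a₆
  | .y1 => b₁ | .y2 => b₂ | .y3 => b₃ | .y4 => b₄ | .y5 => b₅ | .y6 => b₆

theorem iterDegree_zero : iterDegree 0 = letterVec 1 2 2 2 2 2 2 2 2 2 2 2 := by
  funext a; cases a <;> rfl

theorem iterDegree_succ_of_eq {m : ℕ} {a₁ a₂ a₃ a₄ a₅ a₆ b₁ b₂ b₃ b₄ b₅ b₆ : ℤ}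
    (h : iterDegree m = letterVec a₁ a₂ a₃ a₄ a₅ a₆ b₁ b₂ b₃ b₄ b₅ b₆) :
    iterDegree (m + 1) = letterVec (a₁ + a₂ + b₁ + b₂) (a₁ + a₃ + b₁ + b₃) (a₁ + a₄ + b₁ + b₄)
      (a₁ + a₅ + b₁ + b₅) (a₁ + a₆ + b₁ + b₆) (a₂ + a₃ + b₂ + b₃) (a₂ + a₄ + b₂ + b₅)
      (a₂ + a₅ + b₃ + b₄) (a₂ + a₆ + b₂ + b₆) (a₃ + a₄ + b₃ + b₅) (a₃ + a₅ + b₃ + b₆)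
      (a₃ + a₆ + b₄ + b₅) := by
  funext a
  cases a <;> simp only [iterDegree, h] <;> rfl

/-- The linear recurrence given by the polynomial relation
`t ^ 11 = t ^ 10 + 8 t ^ 9 + 16 t ^ 8 + 2 t ^ 7 - 5 t ^ 6 - 5 t ^ 5 - 21 t ^ 4 - 31 t ^ 3 + 10 t ^ 2
+ 8 t` that the incidence matrix of `φ` satisfies on the row vector of the letter degrees. -/
theorem iterDegree_recurrence (m : ℕ) : ∀ a : Letter, iterDegree (m + 11) a =
    iterDegree (m + 10) a + 8 * iterDegree (m + 9) a + 16 * iterDegree (m + 8) a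
      + 2 * iterDegree (m + 7) a - 5 * iterDegree (m + 6) a - 5 * iterDegree (m + 5) a
      - 21 * iterDegree (m + 4) a - 31 * iterDegree (m + 3) a + 10 * iterDegree (m + 2) a
      + 8 * iterDegree (m + 1) a := by
  induction m with
  | zero =>
    have h1 := iterDegree_succ_of_eq iterDegree_zero
    norm_num only at h1
    have h2 := iterDegree_succ_of_eq h1
    norm_num only at h2
    have h3 := iterDegree_succ_of_eq h2
    norm_num only at h3
    have h4 := iterDegree_succ_of_eq h3
    norm_num only at h4
    have h5 := iterDegree_succ_of_eq h4
    norm_num only at h5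
    have h6 := iterDegree_succ_of_eq h5
    norm_num only at h6
    have h7 := iterDegree_succ_of_eq h6
    norm_num only at h7
    have h8 := iterDegree_succ_of_eq h7
    norm_num only at h8
    have h9 := iterDegree_succ_of_eq h8
    norm_num only at h9
    have h10 := iterDegree_succ_of_eq h9
    norm_num only at h10
    have h11 := iterDegree_succ_of_eq h10
    norm_num only at h11
    intro a
    simp only [Nat.zero_add, h1, h2, h3, h4, h5, h6, h7, h8, h9, h10, h11]
    cases a <;> norm_num only [letterVec]
  | succ m ih =>
    intro a
    have e0 := ih (image a 0)
    have e1 := ih (image a 1)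
    have e2 := ih (image a 2)
    have e3 := ih (image a 3)
    have hs : ∀ j, iterDegree (m + 1 + j) a = iterDegree (m + j) (image a 0) +
        iterDegree (m + j) (image a 1) + iterDegree (m + j) (image a 2) +
        iterDegree (m + j) (image a 3) := by
      intro j
      rw [add_right_comm, iterDegree]
    simp only [hs]
    linarith

theorem dvd_iterDegree_of_le {z : ℤ} {m : ℕ} (h : ∀ a, z ∣ iterDegree m a) {j : ℕ} (hj : m ≤ j)
    (a : Letter) : z ∣ iterDegree j a := by
  induction j, hj using Nat.le_induction generalizing a with
  | base => exact h a
  | succ j _ ih => exact dvd_add (dvd_add (dvd_add (ih _) (ih _)) (ih _)) (ih _)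

/-- If one can divide by the lowest relevant coefficient of the recurrence, then divisibility of
all the degrees of `φ ^ m` propagates down to small `m`. -/
theorem dvd_iterDegree_descent {z : ℤ} {b m : ℕ}
    (hstep : ∀ j, b ≤ j → (∀ i, j + 1 ≤ i → ∀ a, z ∣ iterDegree i a) → ∀ a, z ∣ iterDegree j a)
    (h : ∀ a, z ∣ iterDegree m a) (a : Letter) : z ∣ iterDegree b a := by
  have key : ∀ k j, b ≤ j → m ≤ j + k → ∀ a, z ∣ iterDegree j a := by
    intro k
    induction k with
    | zero => exact fun j _ hj => dvd_iterDegree_of_le h hj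
    | succ k ih => exact fun j hb hj => hstep j hb fun i hi => ih i (by omega) (by omega)
  exact key m b le_rfl (by omega) a

/-- No prime divides the degrees of the images under `φ ^ m` of all letters. For odd primes this
holds because the lowest coefficient `8` of the recurrence is invertible, and for the prime two
because the next odd coefficient is `31`. -/
theorem exists_not_dvd_iterDegree {p : ℕ} (hp : p.Prime) (m : ℕ) :
    ∃ a, ¬ (p : ℤ) ∣ iterDegree m a := by
  by_contra! h
  have hp' : Prime (p : ℤ) := Nat.prime_iff_prime_int.1 hp
  rcases hp.eq_two_or_odd' with rfl | hodd
  · have h3 := dvd_iterDegree_descent (z := (2 : ℕ)) (b := 3) (fun j hj hi a => by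
      obtain ⟨n, rfl⟩ : ∃ n, j = n + 3 := ⟨j - 3, by omega⟩
      have e := iterDegree_recurrence n a
      have d4 := hi (n + 4) (by omega) a
      have d5 := hi (n + 5) (by omega) a
      have d6 := hi (n + 6) (by omega) a
      have d10 := hi (n + 10) (by omega) a
      have d11 := hi (n + 11) (by omega) a
      push_cast at *
      omega) h .x2
    -- The degree of the image of `x2` under `φ ^ 3` is `121`.
    revert h3
    decide
  · have h1 := dvd_iterDegree_descent (z := p) (b := 1) (fun j hj hi a => by
      obtain ⟨n, rfl⟩ : ∃ n, j = n + 1 := ⟨j - 1, by omega⟩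
      have e := iterDegree_recurrence n a
      have e8 : (p : ℤ) ∣ 2 ^ 3 * iterDegree (n + 1) a := by
        obtain ⟨c2, d2⟩ := hi (n + 2) (by omega) a
        obtain ⟨c3, d3⟩ := hi (n + 3) (by omega) a
        obtain ⟨c4, d4⟩ := hi (n + 4) (by omega) a
        obtain ⟨c5, d5⟩ := hi (n + 5) (by omega) a
        obtain ⟨c6, d6⟩ := hi (n + 6) (by omega) a
        obtain ⟨c7, d7⟩ := hi (n + 7) (by omega) a
        obtain ⟨c8, d8⟩ := hi (n + 8) (by omega) a
        obtain ⟨c9, d9⟩ := hi (n + 9) (by omega) a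
        obtain ⟨c10, d10⟩ := hi (n + 10) (by omega) a
        obtain ⟨c11, d11⟩ := hi (n + 11) (by omega) a
        refine ⟨c11 - c10 - 8 * c9 - 16 * c8 - 2 * c7 + 5 * c6 + 5 * c5 + 21 * c4 + 31 * c3
          - 10 * c2, ?_⟩
        linear_combination -e + d11 - d10 - 8 * d9 - 16 * d8 - 2 * d7 + 5 * d6 + 5 * d5 + 21 * d4
          + 31 * d3 - 10 * d2
      refine (hp'.dvd_or_dvd e8).resolve_left fun h2 => ?_
      have h2' : p ∣ 2 := by exact_mod_cast hp'.dvd_of_dvd_pow h2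
      rw [(Nat.prime_dvd_prime_iff_eq hp Nat.prime_two).1 h2'] at hodd
      exact absurd hodd (by decide)) h
    -- The images of `x1` and of `x6` under `φ` have the degrees `7` and `8`.
    have h7 : (p : ℤ) ∣ 7 := h1 .x1
    have h8 : (p : ℤ) ∣ 8 := h1 .x6
    exact hp'.not_isUnit (isUnit_of_dvd_one (by simpa using dvd_sub h8 h7))

theorem eq_top_of_iterDegree_mem {H : AddSubgroup ℤ} {m : ℕ} (h : ∀ a, iterDegree m a ∈ H) :
    H = ⊤ := by
  obtain ⟨g, rfl⟩ := Int.subgroup_cyclic H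
  simp only [← AddSubgroup.zmultiples_eq_closure, Int.mem_zmultiples_iff] at h
  have hg : g.natAbs = 1 := by
    by_contra hne
    obtain ⟨p, hp, hpg⟩ := Nat.exists_prime_and_dvd hne
    obtain ⟨a, ha⟩ := exists_not_dvd_iterDegree hp m
    exact ha ((Int.natCast_dvd.2 hpg).trans (h a))
  rw [← AddSubgroup.zmultiples_eq_closure]
  rw [eq_top_iff]
  intro x _
  rw [Int.mem_zmultiples_iff]
  exact (Int.isUnit_iff_natAbs_eq.2 hg).dvd

/-! ### Degrees of prefixes modulo `d` -/

section Word

variable {w : ℕ → Letter}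

/-- The degree of the prefix of length `n`. -/
def prefixDegree (w : ℕ → Letter) (n : ℕ) : ℕ :=
  ∑ i ∈ Finset.range n, letterDegree (w i)

theorem prefixDegree_succ (n : ℕ) :
    prefixDegree w (n + 1) = prefixDegree w n + letterDegree (w n) :=
  Finset.sum_range_succ _ _

theorem letterDegree_pos (a : Letter) : 0 < letterDegree a := by
  revert a; decide

theorem letterDegree_eq_two {a : Letter} (ha : a ≠ .x1) : letterDegree a = 2 := by
  revert a; decide

theorem prefixDegree_strictMono : StrictMono (prefixDegree w) :=
  strictMono_nat_of_lt_succ fun n => by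
    rw [prefixDegree_succ]
    exact Nat.lt_add_of_pos_right (letterDegree_pos _)

theorem IsFixedPoint.prefixDegree_pow_mul (hw : IsFixedPoint φ w) (m n : ℕ) :
    (prefixDegree w (4 ^ m * n) : ℤ) = ∑ i ∈ Finset.range n, iterDegree m (w i) := by
  induction m generalizing n with
  | zero => simp [prefixDegree, iterDegree]
  | succ m ih =>
    rw [pow_succ, mul_assoc, ih]
    induction n with
    | zero => simp
    | succ n ihn =>
      rw [Finset.sum_range_succ, ← ihn, show 4 * (n + 1) = 4 * n + 1 + 1 + 1 + 1 by ring]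
      simp only [Finset.sum_range_succ]
      have h := fun j hj => hw.apply_four_mul_add n (j := j) hj
      have h0 : w (4 * n) = image (w n) 0 := h 0 (by norm_num)
      rw [h0, h 1 (by norm_num), show 4 * n + 1 + 1 = 4 * n + 2 by ring, h 2 (by norm_num),
        show 4 * n + 2 + 1 = 4 * n + 3 by ring, h 3 (by norm_num), iterDegree]
      ring

theorem IsFixedPoint.exists_apply_eq (hw : IsFixedPoint φ w) (hw0 : w 0 = .x1) (a : Letter) :
    ∃ n, w n = a := by
  have h : ∀ n j, j < 4 → w (4 * n + j) = image (w n) j := fun n j hj =>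
    hw.apply_four_mul_add n hj
  have h1 : w 1 = .x2 := by rw [h 0 1 (by norm_num), hw0]; rfl
  have h2 : w 2 = .y1 := by rw [h 0 2 (by norm_num), hw0]; rfl
  have h3 : w 3 = .y2 := by rw [h 0 3 (by norm_num), hw0]; rfl
  have h7 : w 7 = .y3 := by rw [h 1 3 (by norm_num), h1]; rfl
  cases a
  · exact ⟨0, hw0⟩
  · exact ⟨1, h1⟩
  · exact ⟨5, by rw [h 1 1 (by norm_num), h1]; rfl⟩
  · exact ⟨9, by rw [h 2 1 (by norm_num), h2]; rfl⟩
  · exact ⟨13, by rw [h 3 1 (by norm_num), h3]; rfl⟩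
  · exact ⟨29, by rw [h 7 1 (by norm_num), h7]; rfl⟩
  · exact ⟨2, h2⟩
  · exact ⟨3, h3⟩
  · exact ⟨7, h7⟩
  · exact ⟨15, by rw [h 3 3 (by norm_num), h3]; rfl⟩
  · exact ⟨11, by rw [h 2 3 (by norm_num), h2]; rfl⟩
  · exact ⟨31, by rw [h 7 3 (by norm_num), h7]; rfl⟩

theorem image_image_zero (a : Letter) : image (image a 0) 0 = .x1 := by
  revert a; decide

theorem IsFixedPoint.apply_sixteen_mul (hw : IsFixedPoint φ w) (n : ℕ) : w (16 * n) = .x1 := by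
  have h0 : ∀ n, w (4 * n) = image (w n) 0 := fun n =>
    hw.apply_four_mul_add n (j := 0) (by norm_num)
  rw [show 16 * n = 4 * (4 * n) by ring, h0, h0, image_image_zero]

/-- If the degrees of the prefixes that end where the blocks `φ ^ m (x1)` start all lie in a
subgroup of `ℤ`, then this subgroup is everything. -/
theorem IsFixedPoint.eq_top_of_prefixDegree_mem (hw : IsFixedPoint φ w) (hw0 : w 0 = .x1)
    {H : AddSubgroup ℤ} (m : ℕ)
    (h : ∀ n, w n = .x1 → (prefixDegree w (4 ^ m * n) : ℤ) ∈ H) : H = ⊤ := by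
  have h2 : ∀ n, ∑ i ∈ Finset.range n, iterDegree (m + 2) (w i) ∈ H := by
    intro n
    rw [← hw.prefixDegree_pow_mul, show 4 ^ (m + 2) * n = 4 ^ m * (16 * n) by ring]
    exact h _ (hw.apply_sixteen_mul n)
  refine eq_top_of_iterDegree_mem (m := m + 2) fun a => ?_
  obtain ⟨n, rfl⟩ := hw.exists_apply_eq hw0 a
  have e := H.sub_mem (h2 (n + 1)) (h2 n)
  rwa [Finset.sum_range_succ, add_sub_cancel_left] at e

theorem prefixDegree_add {q P : ℕ} (h : ∀ t < P, w (q + t) = w t) {t : ℕ} (ht : t ≤ P) :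
    prefixDegree w (q + t) = prefixDegree w q + prefixDegree w t := by
  induction t with
  | zero => simp [prefixDegree]
  | succ t ih =>
    rw [← add_assoc, prefixDegree_succ, prefixDegree_succ, ih (by omega), h t (by omega), add_assoc]

open Classical in
/-- The residues modulo `d` that are not skipped by the degrees of the prefixes of `w` that end in
the window of length `L` at position `p`. A degree is skipped where `w` has a letter of degree
two. -/
noncomputable def unskipped (w : ℕ → Letter) (d : ℕ) [NeZero d] (p L : ℕ) : Finset (ZMod d) :=
  {r | ∀ t < L, w (p + t) ≠ .x1 → (prefixDegree w (p + t) : ZMod d) + 1 ≠ r}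

theorem mem_unskipped {d : ℕ} [NeZero d] {p L : ℕ} {r : ZMod d} : r ∈ unskipped w d p L ↔
    ∀ t < L, w (p + t) ≠ .x1 → (prefixDegree w (p + t) : ZMod d) + 1 ≠ r := by
  simp [unskipped]

theorem unskipped_subset {d : ℕ} [NeZero d] {p L p' L' : ℕ} (hp : p ≤ p')
    (hL : p' + L' ≤ p + L) : unskipped w d p L ⊆ unskipped w d p' L' := by
  intro r hr
  rw [mem_unskipped] at hr ⊢
  intro t ht
  rw [show p' + t = p + (p' - p + t) by omega]
  exact hr _ (by omega)

theorem mem_unskipped_iff_of_agree {d : ℕ} [NeZero d] {q P : ℕ} (h : ∀ t < P, w (q + t) = w t)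
    {r : ZMod d} : r ∈ unskipped w d q P ↔ r - prefixDegree w q ∈ unskipped w d 0 P := by
  rw [mem_unskipped, mem_unskipped]
  refine forall₂_congr fun t ht => ?_
  rw [Nat.zero_add, h t ht, prefixDegree_add h ht.le, ne_eq, ne_eq, ne_eq, eq_sub_iff_add_eq]
  push_cast
  rw [show (prefixDegree w q : ZMod d) + prefixDegree w t + 1
    = prefixDegree w t + 1 + prefixDegree w q by ring]

/-- Sufficiently long windows of `w` skip every residue modulo `d`. A window with the least number
of unskipped residues can be taken to be a block `φ ^ m (x1)`; by minimality, enlarging the window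
to contain further copies of this block does not change the set of unskipped residues, which is
hence invariant under translation by the distances between the copies. -/
theorem IsFixedPoint.exists_unskipped_eq_empty (hw : IsFixedPoint φ w) (hw0 : w 0 = .x1)
    (d : ℕ) [NeZero d] : ∃ N, ∀ i l, N ≤ l → unskipped w d i l = ∅ := by
  by_contra! hcon
  have hne : ∀ p L, (unskipped w d p L).Nonempty := by
    intro p L
    obtain ⟨K, hK⟩ := hw.exists_recurrence hw0 (p + L)
    obtain ⟨i, l, hl, r, hr⟩ := hcon (K + (p + L))
    obtain ⟨s, hs, hagree⟩ := hK i
    have h1 : r ∈ unskipped w d (i + s) (p + L) := unskipped_subset (by omega) (by omega) hr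
    exact ⟨_, unskipped_subset (by omega) (by omega) ((mem_unskipped_iff_of_agree hagree).1 h1)⟩
  obtain ⟨⟨p, L⟩, hmin⟩ : ∃ x : ℕ × ℕ, ∀ y : ℕ × ℕ,
      (unskipped w d x.1 x.2).card ≤ (unskipped w d y.1 y.2).card :=
    ⟨Function.argmin fun x : ℕ × ℕ => (unskipped w d x.1 x.2).card, fun y =>
      Function.argmin_le (fun x : ℕ × ℕ => (unskipped w d x.1 x.2).card) y⟩
  have hlt : p + L + 1 < 4 ^ (p + L + 1) := Nat.lt_pow_self (by norm_num)
  set m := p + L + 1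
  set G := unskipped w d 0 (4 ^ m) with hG
  have hGmin : ∀ p' L', G.card ≤ (unskipped w d p' L').card := fun p' L' =>
    (Finset.card_le_card (unskipped_subset (by omega) (by omega))).trans (hmin (p', L'))
  have htrans : ∀ n, w n = .x1 → ∀ r ∈ G, r - prefixDegree w (4 ^ m * n) ∈ G := by
    intro n hn r hr
    have hagree : ∀ t < 4 ^ m, w (4 ^ m * n + t) = w t := by
      intro t ht
      have e := hw.apply_pow_mul_add m (hn.trans hw0.symm) t ht
      rwa [Nat.mul_zero, Nat.zero_add] at e
    rw [hG, ← mem_unskipped_iff_of_agree hagree]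
    -- By minimality, the larger window that contains both copies has the same unskipped residues.
    have hbig : unskipped w d 0 (4 ^ m * n + 4 ^ m) = G :=
      Finset.eq_of_subset_of_card_le (unskipped_subset le_rfl (by omega)) (hGmin _ _)
    rw [← hbig] at hr
    exact unskipped_subset (Nat.zero_le _) (by omega) hr
  -- The integers that map the set `G` onto itself by translation.
  let H : AddSubgroup ℤ :=
    { carrier := {t | ∀ r, r - (t : ZMod d) ∈ G ↔ r ∈ G}
      zero_mem' := by simp
      add_mem' := by
        intro a b ha hb r
        rw [Int.cast_add, ← sub_sub, hb, ha]
      neg_mem' := by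
        intro a ha r
        rw [← ha, Int.cast_neg, sub_neg_eq_add, add_sub_cancel_right] }
  have hH : H = ⊤ := by
    refine hw.eq_top_of_prefixDegree_mem hw0 m fun n hn r => ?_
    have himage : G.image (fun r => r - (prefixDegree w (4 ^ m * n) : ZMod d)) = G := by
      refine Finset.eq_of_subset_of_card_le (Finset.image_subset_iff.2 (htrans n hn)) ?_
      rw [Finset.card_image_of_injective _ sub_left_injective]
    rw [Int.cast_natCast]
    conv_lhs => rw [← himage]
    exact Function.Injective.mem_finset_image
      (f := fun r => r - (prefixDegree w (4 ^ m * n) : ZMod d)) sub_left_injective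
  -- So `G` is closed under all translations, and contains the residue that is skipped at `w 1`.
  obtain ⟨r, hr⟩ := hne 0 (4 ^ m)
  obtain ⟨t, ht⟩ := ZMod.intCast_surjective (r - ((prefixDegree w 1 : ZMod d) + 1))
  have hmem : t ∈ H := hH ▸ AddSubgroup.mem_top t
  have h1 : (prefixDegree w 1 : ZMod d) + 1 ∈ G := by
    have e := (hmem r).2 hr
    rwa [ht, sub_sub_cancel] at e
  have hw1 : w (0 + 1) ≠ .x1 := by
    have e := hw.apply_four_mul_add 0 (j := 1) (by norm_num)
    rw [hw0] at e
    exact fun h => absurd (h.symm.trans e) (by decide)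
  exact mem_unskipped.1 h1 1 (by omega) hw1 (by rw [Nat.zero_add])

/-! ### Products of words of the same degree -/

/-- The words that are products of `n + 1` words of degree `d`. -/
def IsBlockProduct {X : Type*} (deg : X → ℕ) (d : ℕ) : ℕ → List X → Prop
  | 0, u => (u.map deg).sum = d
  | n + 1, u => ∃ v z, u = v ++ z ∧ IsBlockProduct deg d n v ∧ (z.map deg).sum = d

theorem prefixDegree_add_length {u : List Letter} {i : ℕ}
    (h : ∀ (t : ℕ) (ht : t < u.length), u[t] = w (i + t)) :
    prefixDegree w (i + u.length) = prefixDegree w i + (u.map letterDegree).sum := by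
  induction u using List.reverseRecOn with
  | nil => simp
  | append_singleton u a ih =>
    have h1 := ih fun t ht => by
      rw [← h t (by simp; omega), List.getElem_append_left ht]
    have h2 := h u.length (by simp)
    rw [List.getElem_concat_length rfl] at h2
    rw [List.length_append, List.length_singleton, ← add_assoc, prefixDegree_succ, h1, ← h2]
    simp [add_assoc]

theorem IsBlockProduct.exists_prefixDegree {d n i : ℕ} {u : List Letter}
    (hu : IsBlockProduct letterDegree d n u)
    (h : ∀ (t : ℕ) (ht : t < u.length), u[t] = w (i + t)) :
    prefixDegree w (i + u.length) = prefixDegree w i + (n + 1) * d ∧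
      ∀ j ≤ n + 1, ∃ t, prefixDegree w (i + t) = prefixDegree w i + j * d := by
  induction n generalizing u with
  | zero =>
    have e := prefixDegree_add_length h
    have hu' : (u.map letterDegree).sum = d := hu
    rw [hu'] at e
    refine ⟨by simpa using e, fun j hj => ?_⟩
    rcases (by omega : j = 0 ∨ j = 1) with rfl | rfl
    · exact ⟨0, by simp⟩
    · exact ⟨_, by simpa using e⟩
  | succ n ih =>
    obtain ⟨v, z, rfl, hv, hz⟩ := hu
    obtain ⟨h1, h2⟩ := ih hv fun t ht => by
      rw [← h t (by simp; omega), List.getElem_append_left ht]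
    have h3 : prefixDegree w (i + v.length + z.length) =
        prefixDegree w (i + v.length) + (z.map letterDegree).sum :=
      prefixDegree_add_length fun t ht => by
        rw [add_assoc, ← h (v.length + t) (by simp; omega), List.getElem_append_right (by omega)]
        congr 1
        omega
    have h4 : prefixDegree w (i + (v ++ z).length) = prefixDegree w i + (n + 1 + 1) * d := by
      rw [List.length_append, ← add_assoc, h3, h1, hz]
      ring
    refine ⟨h4, fun j hj => ?_⟩
    rcases Nat.lt_or_ge j (n + 2) with hj' | hj'
    · exact h2 j (by omega)
    · obtain rfl : j = n + 1 + 1 := by omega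
      exact ⟨_, h4⟩

theorem sum_letterDegree_le (u : List Letter) : (u.map letterDegree).sum ≤ 2 * u.length := by
  induction u with
  | nil => simp
  | cons a u ih =>
    have : letterDegree a ≤ 2 := by revert a; decide
    simp only [List.map_cons, List.sum_cons, List.length_cons]
    omega

/-- Products of many words of the same degree `d ≥ 1` are not subwords of `w`, because the degrees
of the prefixes of `w` would run through a long arithmetic progression of difference `d`. -/
theorem IsFixedPoint.exists_isBlockProduct_not_isSubword (hw : IsFixedPoint φ w)
    (hw0 : w 0 = .x1) {d : ℕ} (hd : 0 < d) :
    ∃ N, ∀ u, IsBlockProduct letterDegree d N u → ¬ IsSubword u w := by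
  have : NeZero d := ⟨hd.ne'⟩
  obtain ⟨N, hN⟩ := hw.exists_unskipped_eq_empty hw0 d
  refine ⟨2 * N, fun u hu hsub => ?_⟩
  obtain ⟨i, hi⟩ := isSubword_iff.1 hsub
  obtain ⟨hlen, hj⟩ := hu.exists_prefixDegree hi
  have hul : N ≤ u.length := by
    have h1 := prefixDegree_add_length hi
    have h2 := sum_letterDegree_le u
    have h3 : (2 * N + 1) * 1 ≤ (2 * N + 1) * d := Nat.mul_le_mul_left _ hd
    omega
  have hmem : (prefixDegree w i : ZMod d) ∈ unskipped w d i u.length := by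
    rw [mem_unskipped]
    intro t ht hx heq
    have hcong : prefixDegree w i ≡ prefixDegree w (i + t) + 1 [MOD d] := by
      rw [← ZMod.natCast_eq_natCast_iff]
      push_cast
      exact heq.symm
    have hle : prefixDegree w i ≤ prefixDegree w (i + t) :=
      prefixDegree_strictMono.monotone (by omega)
    have hskip : prefixDegree w (i + t + 1) = prefixDegree w (i + t) + 2 := by
      rw [prefixDegree_succ, letterDegree_eq_two hx]
    have hle' : prefixDegree w (i + t + 1) ≤ prefixDegree w (i + u.length) :=
      prefixDegree_strictMono.monotone (by omega)
    obtain ⟨j, hjd⟩ := (Nat.modEq_iff_dvd' (by omega)).1 hcong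
    have hj' : j ≤ 2 * N + 1 := by
      by_contra hlt
      have : d * (2 * N + 1) ≤ d * j := Nat.mul_le_mul_left _ (by omega)
      rw [mul_comm (2 * N + 1) d] at hlen
      omega
    obtain ⟨s, hs⟩ := hj j hj'
    rw [mul_comm] at hs
    -- The degree `prefixDegree w (i + t) + 1` is skipped, but it is attained at `i + s`.
    have h1 : prefixDegree w (i + t) < prefixDegree w (i + s) := by omega
    have h2 : prefixDegree w (i + s) < prefixDegree w (i + t + 1) := by omega
    rw [prefixDegree_strictMono.lt_iff_lt] at h1 h2
    omega
  rw [hN i _ hul] at hmem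
  exact absurd hmem (Finset.notMem_empty _)

end Word

/-! ### Occurrences of finite words -/

section Occurrence

variable {X : Type*} {w : ℕ → X}

/-- The finite word `u` occurs in `w` at position `i`. -/
def OccursAt (u : List X) (w : ℕ → X) (i : ℕ) : Prop :=
  ∀ (t : ℕ) (ht : t < u.length), u[t] = w (i + t)

theorem isSubword_iff_exists_occursAt {u : List X} : IsSubword u w ↔ ∃ i, OccursAt u w i :=
  isSubword_iff

theorem occursAt_nil (i : ℕ) : OccursAt [] w i := fun _ ht => absurd ht (Nat.not_lt_zero _)

theorem occursAt_append {u v : List X} {i : ℕ} :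
    OccursAt (u ++ v) w i ↔ OccursAt u w i ∧ OccursAt v w (i + u.length) := by
  constructor
  · refine fun h => ⟨fun t ht => ?_, fun t ht => ?_⟩
    · rw [← h t (by simp; omega), List.getElem_append_left ht]
    · rw [add_assoc, ← h (u.length + t) (by simp; omega), List.getElem_append_right (by omega)]
      congr 1
      omega
  · rintro ⟨hu, hv⟩ t ht
    rw [List.length_append] at ht
    rcases Nat.lt_or_ge t u.length with h | h
    · rw [List.getElem_append_left h, hu t h]
    · rw [List.getElem_append_right h, hv _ (by omega)]
      congr 1
      omega

theorem occursAt_cons {a : X} {u : List X} {i : ℕ} :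
    OccursAt (a :: u) w i ↔ w i = a ∧ OccursAt u w (i + 1) := by
  rw [← List.singleton_append, occursAt_append]
  refine and_congr ⟨fun h => (h 0 (by simp)).symm, fun h t ht => ?_⟩ Iff.rfl
  obtain rfl : t = 0 := by simpa using ht
  exact h.symm

theorem OccursAt.eq {u v : List X} {i : ℕ} (hu : OccursAt u w i) (hv : OccursAt v w i)
    (h : u.length = v.length) : u = v :=
  List.ext_getElem h fun t h1 h2 => (hu t h1).trans (hv t h2).symm

theorem IsSubword.of_append_left {u v : List X} (h : IsSubword (u ++ v) w) : IsSubword u w := by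
  obtain ⟨i, hi⟩ := isSubword_iff_exists_occursAt.1 h
  exact isSubword_iff_exists_occursAt.2 ⟨i, (occursAt_append.1 hi).1⟩

/-- The word of length `n` that occurs in `w` at position `i`. -/
def window (w : ℕ → X) (i n : ℕ) : List X :=
  (List.range n).map fun t => w (i + t)

@[simp]
theorem length_window (i n : ℕ) : (window w i n).length = n := by simp [window]

theorem occursAt_window_iff {i j n : ℕ} :
    OccursAt (window w i n) w j ↔ ∀ t < n, w (i + t) = w (j + t) := by
  simp [OccursAt, window]

theorem occursAt_window (i n : ℕ) : OccursAt (window w i n) w i :=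
  occursAt_window_iff.2 fun _ _ => rfl

theorem isSubword_window (i n : ℕ) : IsSubword (window w i n) w :=
  isSubword_iff_exists_occursAt.2 ⟨i, occursAt_window i n⟩

theorem OccursAt.eq_window {u : List X} {i : ℕ} (h : OccursAt u w i) :
    u = window w i u.length :=
  h.eq (occursAt_window _ _) (by simp)

end Occurrence

/-! ### The action of the monomial algebra on sequences -/

section Action

variable (k : Type*) [Field k] {X : Type*} (w : ℕ → X)

open Classical in
/-- The letter `a` acts on sequences: it shifts a sequence by one place and then erases the entries
at the positions at which `w` does not have the letter `a`. -/
noncomputable def letterAction (a : X) : Module.End k (ℕ → k) where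
  toFun f i := if w i = a then f (i + 1) else 0
  map_add' f g := by
    funext i
    by_cases h : w i = a <;> simp [h]
  map_smul' c f := by
    funext i
    by_cases h : w i = a <;> simp [h]

open Classical in
theorem lift_letterAction_freeMonomial (u : List X) (f : ℕ → k) (i : ℕ) :
    FreeAlgebra.lift k (letterAction k w) (freeMonomial k u) f i =
      if OccursAt u w i then f (i + u.length) else 0 := by
  induction u generalizing f i with
  | nil => simp [freeMonomial, occursAt_nil]
  | cons a u ih =>
    have h : freeMonomial k (a :: u) = FreeAlgebra.ι k a * freeMonomial k u := by
      simp [freeMonomial]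
    rw [h, map_mul, FreeAlgebra.lift_ι_apply, Module.End.mul_apply, occursAt_cons]
    change (if w i = a then _ else _) = _
    rw [ih, List.length_cons, ← add_assoc, add_right_comm]
    by_cases h1 : w i = a <;> simp [h1]

/-- The algebra `A_w` acts on sequences. -/
noncomputable def action : IterativeAlgebra k w →ₐ[k] Module.End k (ℕ → k) :=
  RingQuot.liftAlgHom k ⟨FreeAlgebra.lift k (letterAction k w), by
    rintro _ _ ⟨⟨u, hu, rfl⟩, rfl⟩
    rw [map_zero]
    refine LinearMap.ext fun f => funext fun i => ?_
    rw [lift_letterAction_freeMonomial, if_neg fun h => hu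
      (isSubword_iff_exists_occursAt.2 ⟨i, h⟩)]
    rfl⟩

open Classical in
theorem action_monomial (u : List X) (f : ℕ → k) (i : ℕ) :
    action k w (monomial k w u) f i = if OccursAt u w i then f (i + u.length) else 0 := by
  rw [monomial, action, RingQuot.liftAlgHom_mkAlgHom_apply, lift_letterAction_freeMonomial]

theorem monomial_eq_zero {w : ℕ → X} {u : List X} (hu : ¬ IsSubword u w) :
    monomial k w u = 0 := by
  have h : IsRelation k w (freeMonomial k u) 0 := ⟨⟨u, hu, rfl⟩, rfl⟩
  rw [monomial, RingQuot.mkAlgHom_rel k h, map_zero]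

/-- The coefficient of a word, read off at a position at which the word occurs. -/
noncomputable def coeffAt (i n : ℕ) : IterativeAlgebra k w →ₗ[k] k :=
  LinearMap.proj i ∘ₗ LinearMap.applyₗ (Pi.single (i + n) 1) ∘ₗ (action k w).toLinearMap

open Classical in
theorem coeffAt_monomial (i n : ℕ) (u : List X) :
    coeffAt k w i n (monomial k w u) = if u = window w i n then 1 else 0 := by
  have h : coeffAt k w i n (monomial k w u) =
    action k w (monomial k w u) (Pi.single (i + n) 1) i := rfl
  rw [h, action_monomial]
  by_cases hu : u = window w i n
  · rw [if_pos hu, hu, if_pos (occursAt_window i n), length_window, Pi.single_eq_same]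
  · rw [if_neg hu]
    by_cases ho : OccursAt u w i
    · rw [if_pos ho, Pi.single_eq_of_ne]
      intro hl
      apply hu
      rw [← Nat.add_left_cancel hl]
      exact ho.eq_window
    · rw [if_neg ho]

theorem linearIndependent_monomial :
    LinearIndependent k fun u : {u : List X // IsSubword u w} => monomial k w u := by
  classical
  choose pos hpos using fun u : {u : List X // IsSubword u w} =>
    isSubword_iff_exists_occursAt.1 u.2
  refine .of_pairwise_dual_eq_zero_one _ (fun u => coeffAt k w (pos u) u.1.length) ?_ ?_
  · intro u v huv
    rw [coeffAt_monomial, ← (hpos u).eq_window, if_neg fun h => huv (Subtype.ext h.symm)]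
  · intro u
    rw [coeffAt_monomial, ← (hpos u).eq_window, if_pos rfl]

end Action

/-! ### The positive part and its basis of monomials -/

section PositivePart

variable (k : Type*) [Field k] (w : ℕ → Letter)

theorem sum_letterDegree_pos {u : List Letter} (hu : u ≠ []) : 0 < (u.map letterDegree).sum := by
  obtain ⟨a, u, rfl⟩ := List.exists_cons_of_ne_nil hu
  have := letterDegree_pos a
  rw [List.map_cons, List.sum_cons]
  omega

theorem gradedPiece_le_positivePart (d : ℕ) : gradedPiece k w letterDegree (d + 1) ≤
    NonUnitalSubalgebra.toSubmodule (positivePart k w letterDegree) :=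
  le_iSup (fun d : ℕ => gradedPiece k w letterDegree (d + 1)) d

theorem monomial_mem_positivePart {u : List Letter} (hu : u ≠ []) :
    monomial k w u ∈ positivePart k w letterDegree := by
  have hpos := sum_letterDegree_pos hu
  exact gradedPiece_le_positivePart k w ((u.map letterDegree).sum - 1)
    (Submodule.subset_span ⟨u, by omega, rfl⟩)

open Classical in
/-- A nonempty finite word, as an element of the positive part of `A_w`; the empty word, whose
image in `A_w` does not lie in the positive part, is sent to zero. -/
noncomputable def posMonomial (u : List Letter) : positivePart k w letterDegree :=
  if h : u = [] then 0 else ⟨monomial k w u, monomial_mem_positivePart k w h⟩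

theorem posMonomial_nil : posMonomial k w [] = 0 := dif_pos rfl

theorem coe_posMonomial {u : List Letter} (hu : u ≠ []) :
    (posMonomial k w u : IterativeAlgebra k w) = monomial k w u := by
  rw [posMonomial, dif_neg hu]

theorem posMonomial_append {u v : List Letter} (hu : u ≠ []) (hv : v ≠ []) :
    posMonomial k w (u ++ v) = posMonomial k w u * posMonomial k w v := by
  apply Subtype.ext
  rw [MulMemClass.coe_mul, coe_posMonomial k w hu, coe_posMonomial k w hv,
    coe_posMonomial k w (by simp [hu]), monomial_append]

variable {w} in
theorem posMonomial_eq_zero {u : List Letter} (hu : ¬ IsSubword u w) : posMonomial k w u = 0 := by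
  by_cases h : u = []
  · rw [h, posMonomial_nil]
  · apply Subtype.ext
    rw [coe_posMonomial k w h, monomial_eq_zero k hu]
    rfl

/-- The homogeneous elements of positive degree `d + 1` are spanned by words inside the positive
part. -/
theorem mem_span_posMonomial_of_mem_gradedPiece {d : ℕ} {x : positivePart k w letterDegree}
    (hx : (x : IterativeAlgebra k w) ∈ gradedPiece k w letterDegree (d + 1)) :
    x ∈ Submodule.span k (posMonomial k w '' {u | (u.map letterDegree).sum = d + 1}) := by
  have h : gradedPiece k w letterDegree (d + 1) ≤
      (Submodule.span k (posMonomial k w '' {u | (u.map letterDegree).sum = d + 1})).map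
        (NonUnitalSubalgebra.toSubmodule (positivePart k w letterDegree)).subtype := by
    rw [gradedPiece, Submodule.span_le]
    rintro _ ⟨u, hu, rfl⟩
    have hne : u ≠ [] := by rintro rfl; simp at hu
    exact ⟨posMonomial k w u, Submodule.subset_span ⟨u, hu, rfl⟩, coe_posMonomial k w hne⟩
  obtain ⟨y, hy, hyx⟩ := h hx
  rwa [show x = y from Subtype.ext hyx.symm]

theorem span_range_posMonomial : Submodule.span k (Set.range (posMonomial k w)) = ⊤ := by
  have h : NonUnitalSubalgebra.toSubmodule (positivePart k w letterDegree) ≤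
      (Submodule.span k (Set.range (posMonomial k w))).map
        (NonUnitalSubalgebra.toSubmodule (positivePart k w letterDegree)).subtype := by
    refine iSup_le fun d x hx => ?_
    exact ⟨⟨x, gradedPiece_le_positivePart k w d hx⟩,
      Submodule.span_mono (Set.image_subset_range _ _)
      (mem_span_posMonomial_of_mem_gradedPiece k w hx), rfl⟩
  rw [eq_top_iff]
  rintro x -
  obtain ⟨y, hy, hyx⟩ := h x.2
  rwa [show x = y from Subtype.ext hyx.symm]

theorem linearIndependent_posMonomial : LinearIndependent k
    fun u : {u : List Letter // IsSubword u w ∧ u ≠ []} => posMonomial k w u := by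
  refine LinearIndependent.of_comp
    (NonUnitalSubalgebra.toSubmodule (positivePart k w letterDegree)).subtype ?_
  have h := (linearIndependent_monomial k w).comp
    (fun u : {u : List Letter // IsSubword u w ∧ u ≠ []} => ⟨u.1, u.2.1⟩)
    (fun u v huv => Subtype.ext (Subtype.mk.inj huv))
  rw [show (NonUnitalSubalgebra.toSubmodule (positivePart k w letterDegree)).subtype ∘
      (fun u : {u : List Letter // IsSubword u w ∧ u ≠ []} => posMonomial k w u) =
      fun u => monomial k w u.1 from funext fun u => coe_posMonomial k w u.2.2]
  exact h

/-- Elements of the positive part have constant coefficient zero. -/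
theorem coeffAt_coe_eq_zero (x : positivePart k w letterDegree) :
    coeffAt k w 0 0 (x : IterativeAlgebra k w) = 0 := by
  have hx : x ∈ Submodule.span k (Set.range (posMonomial k w)) := by
    rw [span_range_posMonomial]
    trivial
  induction hx using Submodule.span_induction with
  | mem x hx =>
    obtain ⟨u, rfl⟩ := hx
    by_cases hu : u = []
    · rw [hu, posMonomial_nil]
      exact map_zero _
    · rw [coe_posMonomial k w hu, coeffAt_monomial, if_neg]
      simpa [window] using hu
  | zero => exact map_zero _
  | add x y _ _ hx hy => rw [NonUnitalSubalgebra.coe_add, map_add, hx, hy, add_zero]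
  | smul c x _ hx => rw [NonUnitalSubalgebra.coe_smul, map_smul, hx, smul_zero]

/-- This includes the degree zero, in which both sides are zero. -/
theorem positivePiece_eq_span (d : ℕ) : positivePiece k w letterDegree d =
    Submodule.span k (posMonomial k w '' {u | (u.map letterDegree).sum = d}) := by
  have hnil : ∀ u : List Letter, (u.map letterDegree).sum = 0 → u = [] := by
    intro u hu
    by_contra hne
    exact (sum_letterDegree_pos hne).ne' hu
  cases d with
  | zero =>
    apply le_antisymm
    · intro x hx
      have hx' : (x : IterativeAlgebra k w) ∈ gradedPiece k w letterDegree 0 := hx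
      have hle : gradedPiece k w letterDegree 0 ≤ Submodule.span k {monomial k w []} := by
        refine Submodule.span_mono ?_
        rintro _ ⟨u, hu, rfl⟩
        rw [hnil u hu]
        rfl
      obtain ⟨c, hc⟩ := Submodule.mem_span_singleton.1 (hle hx')
      have h0 := coeffAt_coe_eq_zero k w x
      rw [← hc, map_smul, coeffAt_monomial, if_pos (by simp [window]), smul_eq_mul, mul_one] at h0
      rw [h0, zero_smul] at hc
      rw [show x = 0 from Subtype.ext hc.symm]
      exact Submodule.zero_mem _
    · rw [Submodule.span_le]
      rintro _ ⟨u, hu, rfl⟩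
      rw [hnil u hu, posMonomial_nil]
      exact Submodule.zero_mem _
  | succ d =>
    apply le_antisymm
    · exact fun x hx => mem_span_posMonomial_of_mem_gradedPiece k w hx
    · rw [Submodule.span_le]
      rintro _ ⟨u, hu, rfl⟩
      have hne : u ≠ [] := by
        rintro rfl
        simp at hu
      change (posMonomial k w u : IterativeAlgebra k w) ∈ gradedPiece k w letterDegree (d + 1)
      rw [coe_posMonomial k w hne]
      exact Submodule.subset_span ⟨u, hu, rfl⟩

end PositivePart

/-! ### Algebras with a basis of words -/

/-- The algebra `R` has the nonempty subwords of `w` as a basis, where `m u` is the element given by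
the word `u`, and words are multiplied by concatenation, with the result zero if this is not a
subword. The value at the empty word, which is not part of the basis, is zero. Moreover `R` acts on
the sequences of scalars so that a word `u` shifts a sequence by the length of `u` and erases the
entries at the positions at which `u` does not occur in `w`. -/
structure IsWordAlgebra (k : Type*) [Field k] (w : ℕ → Letter) {R : Type*} [NonUnitalRing R]
    [Module k R] (m : List Letter → R) : Prop where
  map_nil : m [] = 0
  map_append : ∀ {u v : List Letter}, u ≠ [] → v ≠ [] → m (u ++ v) = m u * m v
  map_eq_zero : ∀ {u : List Letter}, ¬ IsSubword u w → m u = 0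
  linearIndependent : LinearIndependent k fun u : {u : List Letter // IsSubword u w ∧ u ≠ []} =>
    m u
  span_range : Submodule.span k (Set.range m) = ⊤
  exists_action : ∃ ρ : R →ₙ+* Module.End k (ℕ → k), ∀ u, u ≠ [] → ∀ f i,
    (OccursAt u w i → ρ (m u) f i = f (i + u.length)) ∧ (¬ OccursAt u w i → ρ (m u) f i = 0)

theorem isWordAlgebra_posMonomial (k : Type*) [Field k] (w : ℕ → Letter) :
    IsWordAlgebra k w (posMonomial k w) where
  map_nil := posMonomial_nil k w
  map_append hu hv := posMonomial_append k w hu hv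
  map_eq_zero hu := posMonomial_eq_zero k hu
  linearIndependent := linearIndependent_posMonomial k w
  span_range := span_range_posMonomial k w
  exists_action := by
    classical
    refine ⟨{ toFun := fun x => action k w (x : IterativeAlgebra k w)
              map_zero' := map_zero _
              map_add' := fun x y => map_add (action k w) (x : IterativeAlgebra k w) y
              map_mul' := fun x y => map_mul (action k w) (x : IterativeAlgebra k w) y }, ?_⟩
    intro u hu f i
    change (_ → action k w (posMonomial k w u : IterativeAlgebra k w) f i = _) ∧
      (_ → action k w (posMonomial k w u : IterativeAlgebra k w) f i = _)
    rw [coe_posMonomial k w hu, action_monomial]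
    exact ⟨fun h => if_pos h, fun h => if_neg h⟩

/-! ### Algebras that need not have a unit -/

section Ring

variable {k : Type*} [Field k] {R : Type*} [NonUnitalRing R]

theorem exists_mem_ne_zero_of_ne_bot {I : TwoSidedIdeal R} (hI : I ≠ ⊥) : ∃ f ∈ I, f ≠ 0 := by
  by_contra! h
  refine hI (TwoSidedIdeal.ext fun x => ?_)
  rw [TwoSidedIdeal.mem_bot]
  refine ⟨h x, ?_⟩
  rintro rfl
  exact I.zero_mem

theorem mul_sub_mul_eq_of_mul_eq_zero {a b : R} (h : b * a = 0) : a * b - b * a = a * b := by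
  rw [h, sub_zero]

theorem eq_zero_of_jacobsonRadical_eq_top (h : jacobsonRadical R = ⊥)
    (htop : jacobsonRadical R = ⊤) (x : R) : x = 0 := by
  rw [← TwoSidedIdeal.mem_bot, ← h, htop]
  trivial

variable [Module k R]

theorem mul_mem_of_mem_span [IsScalarTower k R R] [SMulCommClass k R R] {s t : Set R}
    {P : Submodule k R} (h : ∀ a ∈ s, ∀ b ∈ t, a * b ∈ P) {x y : R} (hx : x ∈ Submodule.span k s)
    (hy : y ∈ Submodule.span k t) : x * y ∈ P := by
  have hle : Submodule.map₂ (LinearMap.mul k R) (Submodule.span k s) (Submodule.span k t) ≤ P := by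
    rw [Submodule.map₂_span_span, Submodule.span_le]
    rintro _ ⟨a, ha, b, hb, rfl⟩
    exact h a ha b hb
  exact hle (Submodule.apply_mem_map₂ _ hx hy)

theorem finite_quotient_of_span_eq_top {I : Submodule k R} {s t : Set R}
    (hs : Submodule.span k s = ⊤) (ht : t.Finite) (h : ∀ x ∈ s, x ∈ t ∨ x ∈ I) :
    Module.Finite k (R ⧸ I) := by
  refine ⟨⟨(ht.image I.mkQ).toFinset, ?_⟩⟩
  rw [Set.Finite.coe_toFinset, eq_top_iff, ← Submodule.range_mkQ I, LinearMap.range_eq_map, ← hs,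
    Submodule.map_span, Submodule.span_le]
  rintro _ ⟨x, hx, rfl⟩
  rcases h x hx with hx | hx
  · exact Submodule.subset_span ⟨x, hx, rfl⟩
  · rw [(Submodule.Quotient.mk_eq_zero I).2 hx |> (Submodule.mkQ_apply I x).trans]
    exact Submodule.zero_mem _

end Ring

/-! ### Nonzero ideals contain all long words -/

section Recurrence

variable {w : ℕ → Letter}

/-- Every subword of `w` occurs in the interior of all sufficiently long subwords. -/
theorem IsFixedPoint.exists_eq_append_append (hw : IsFixedPoint φ w) (hw0 : w 0 = .x1)
    {u : List Letter} (hu : IsSubword u w) : ∃ K, ∀ v, IsSubword v w → K ≤ v.length →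
      ∃ a b, a ≠ [] ∧ b ≠ [] ∧ v = a ++ (u ++ b) := by
  obtain ⟨i, hi⟩ := isSubword_iff_exists_occursAt.1 hu
  obtain ⟨K, hK⟩ := hw.exists_recurrence hw0 (i + u.length)
  refine ⟨K + (i + u.length) + 2, fun v hv hlen => ?_⟩
  obtain ⟨j, hj⟩ := isSubword_iff_exists_occursAt.1 hv
  obtain ⟨s, hs, h⟩ := hK (j + 1)
  have hocc : OccursAt u w (j + (1 + s + i)) := fun t ht => by
    rw [hi t ht, ← h (i + t) (by omega)]
    congr 1
    omega
  refine ⟨window w j (1 + s + i),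
    window w (j + (1 + s + i) + u.length) (v.length - (1 + s + i) - u.length), ?_, ?_, ?_⟩
  · rw [← List.length_pos_iff, length_window]; omega
  · rw [← List.length_pos_iff, length_window]; omega
  · refine hj.eq (occursAt_append.2 ⟨occursAt_window _ _, occursAt_append.2 ⟨?_, ?_⟩⟩) ?_
    · rwa [length_window]
    · rw [length_window]
      exact occursAt_window _ _
    · simp only [List.length_append, length_window]
      omega

theorem IsFixedPoint.exists_isSubword_append_append (hw : IsFixedPoint φ w) (hw0 : w 0 = .x1)
    {u v : List Letter} (hu : IsSubword u w) (hv : IsSubword v w) :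
    ∃ z, z ≠ [] ∧ IsSubword (u ++ (z ++ v)) w := by
  obtain ⟨i, hi⟩ := isSubword_iff_exists_occursAt.1 hu
  obtain ⟨K, hK⟩ := hw.exists_eq_append_append hw0 hv
  obtain ⟨a, b, ha, -, hab⟩ := hK (window w (i + u.length) K) (isSubword_window _ _) (by simp)
  have h : OccursAt (u ++ (a ++ v) ++ b) w i := by
    rw [List.append_assoc, List.append_assoc, ← hab]
    exact occursAt_append.2 ⟨hi, occursAt_window _ _⟩
  exact ⟨a, ha, IsSubword.of_append_left (isSubword_iff_exists_occursAt.2 ⟨i, h⟩)⟩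

theorem IsFixedPoint.exists_occursAt_ge (hw : IsFixedPoint φ w) (hw0 : w 0 = .x1)
    {u : List Letter} (hu : IsSubword u w) (n : ℕ) : ∃ p, n ≤ p ∧ OccursAt u w p := by
  obtain ⟨K, hK⟩ := hw.exists_eq_append_append hw0 hu
  obtain ⟨a, b, -, -, hab⟩ := hK (window w n K) (isSubword_window _ _) (by simp)
  have h := occursAt_window (w := w) n K
  rw [hab, occursAt_append, occursAt_append] at h
  exact ⟨_, Nat.le_add_right _ _, h.2.1⟩

end Recurrence

namespace IsWordAlgebra

variable {k : Type*} [Field k] {w : ℕ → Letter} {R : Type*} [NonUnitalRing R] [Module k R]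
  {m : List Letter → R}

/-- The basis of nonempty subwords of a word algebra. -/
noncomputable def basis (hm : IsWordAlgebra k w m) :
    Module.Basis {u : List Letter // IsSubword u w ∧ u ≠ []} k R :=
  .mk hm.linearIndependent <| by
    rw [← hm.span_range, Submodule.span_le]
    rintro _ ⟨u, rfl⟩
    by_cases hu : IsSubword u w ∧ u ≠ []
    · exact Submodule.subset_span ⟨⟨u, hu⟩, rfl⟩
    · rw [not_and_not_right] at hu
      have h0 : m u = 0 := by
        by_cases hs : IsSubword u w
        · rw [hu hs, hm.map_nil]
        · exact hm.map_eq_zero hs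
      rw [h0]
      exact Submodule.zero_mem _

theorem basis_apply (hm : IsWordAlgebra k w m)
    (u : {u : List Letter // IsSubword u w ∧ u ≠ []}) : hm.basis u = m u := by
  rw [basis, Module.Basis.mk_apply]

theorem map_ne_zero (hm : IsWordAlgebra k w m) {u : List Letter} (hu : IsSubword u w)
    (hne : u ≠ []) : m u ≠ 0 :=
  hm.linearIndependent.ne_zero ⟨u, hu, hne⟩

theorem map_window_ne_zero (hm : IsWordAlgebra k w m) (i : ℕ) {n : ℕ} (hn : 0 < n) :
    m (window w i n) ≠ 0 :=
  hm.map_ne_zero (isSubword_window i n) (by rwa [← List.length_pos_iff, length_window])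

theorem nontrivial (hm : IsWordAlgebra k w m) : Nontrivial R :=
  nontrivial_of_ne _ _ (hm.map_window_ne_zero 0 one_pos)

theorem jacobsonRadical_ne_top (hm : IsWordAlgebra k w m) (h : jacobsonRadical R = ⊥) :
    jacobsonRadical R ≠ ⊤ :=
  fun htop => hm.map_window_ne_zero 0 one_pos (eq_zero_of_jacobsonRadical_eq_top h htop _)

theorem span_image_eq (hm : IsWordAlgebra k w m) (s : Set (List Letter)) :
    Submodule.span k (m '' s) = Submodule.span k (hm.basis '' {u | u.1 ∈ s}) := by
  apply le_antisymm <;> rw [Submodule.span_le]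
  · rintro _ ⟨u, hu, rfl⟩
    by_cases hs : IsSubword u w
    · by_cases hne : u = []
      · rw [hne, hm.map_nil]
        exact Submodule.zero_mem _
      · exact Submodule.subset_span ⟨⟨u, hs, hne⟩, hu, hm.basis_apply _⟩
    · rw [hm.map_eq_zero hs]
      exact Submodule.zero_mem _
  · rintro _ ⟨u, hu, rfl⟩
    exact Submodule.subset_span ⟨u.1, hu, (hm.basis_apply u).symm⟩

theorem disjoint_span_image (hm : IsWordAlgebra k w m) {s t : Set (List Letter)}
    (h : Disjoint s t) :
    Disjoint (Submodule.span k (m '' s)) (Submodule.span k (m '' t)) := by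
  rw [hm.span_image_eq, hm.span_image_eq]
  refine hm.basis.linearIndependent.disjoint_span_image ?_
  rw [Set.disjoint_left] at h ⊢
  exact fun u hu hu' => h hu hu'

/-- The words of degree `d` span the homogeneous component of degree `d` of a word algebra. -/
theorem isInternal_span (hm : IsWordAlgebra k w m) : DirectSum.IsInternal fun d : ℕ =>
    Submodule.span k (m '' {u | (u.map letterDegree).sum = d}) := by
  refine (DirectSum.isInternal_submodule_iff_iSupIndep_and_iSup_eq_top _).2 ⟨?_, ?_⟩
  · intro d
    have h : ⨆ (j : ℕ) (_ : j ≠ d), Submodule.span k (m '' {u | (u.map letterDegree).sum = j}) ≤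
        Submodule.span k (m '' {u | (u.map letterDegree).sum ≠ d}) := by
      refine iSup₂_le fun j hj => Submodule.span_mono (Set.image_mono ?_)
      rintro u rfl
      exact hj
    exact Disjoint.mono_right h
      (hm.disjoint_span_image (Set.disjoint_left.2 fun u hu hu' => hu' hu))
  · rw [eq_top_iff, ← hm.span_range, Submodule.span_le]
    rintro _ ⟨u, rfl⟩
    exact Submodule.mem_iSup_of_mem (u.map letterDegree).sum (Submodule.subset_span ⟨u, rfl, rfl⟩)

theorem map_window_mem_setPow (hm : IsWordAlgebra k w m) (n : ℕ) :
    m (window w 0 (n + 1)) ∈ setPow (Set.univ : Set R) n := by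
  induction n with
  | zero => exact Set.mem_univ _
  | succ n ih =>
    have hsplit : window w 0 (n + 1 + 1) = window w 0 (n + 1) ++ [w (n + 1)] := by
      simp [window, List.range_succ]
    have hne : window w 0 (n + 1) ≠ [] := by
      rw [← List.length_pos_iff, length_window]
      omega
    rw [hsplit, hm.map_append hne (by simp)]
    exact Set.mul_mem_mul ih (Set.mem_univ _)

theorem not_isNilpotentSet_univ (hm : IsWordAlgebra k w m) :
    ¬ IsNilpotentSet (Set.univ : Set R) := by
  rintro ⟨n, hn⟩
  exact hm.map_window_ne_zero 0 n.succ_pos (hn (hm.map_window_mem_setPow n))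

theorem infinite_subword : Infinite {u : List Letter // IsSubword u w ∧ u ≠ []} :=
  Infinite.of_injective
    (fun n : ℕ => ⟨window w 0 (n + 1), isSubword_window _ _, by
      rw [← List.length_pos_iff, length_window]; omega⟩)
    fun m n h => by
      have e := congrArg (fun u => u.1.length) h
      simpa using e

/-! ### Generation as a Lie algebra -/

/-- The words of length at most two generate: a longer word is the product of two shorter ones
whose product in the reverse order is zero. -/
theorem isFinitelyGeneratedLie (hm : IsWordAlgebra k w m) (hw : IsFixedPoint φ w) :
    IsFinitelyGeneratedLie k R := by
  refine ⟨m '' {u | u.length ≤ 2}, (List.finite_length_le Letter 2).image _,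
    fun L hS hL => ?_⟩
  have h : ∀ n, ∀ u : List Letter, u.length ≤ n → m u ∈ L := by
    intro n
    induction n with
    | zero => exact fun u hu => hS ⟨u, Nat.le_trans hu (Nat.zero_le 2), rfl⟩
    | succ n ih =>
      intro u hu
      by_cases h2 : u.length ≤ 2
      · exact hS ⟨u, h2, rfl⟩
      by_cases hs : IsSubword u w
      · obtain ⟨a, b, ha, hb, rfl, hba⟩ := hw.exists_append_not_isSubword (by omega) hs
        have ha' := List.length_pos_iff.2 ha
        have hb' := List.length_pos_iff.2 hb
        rw [List.length_append] at hu
        have e := hL _ (ih a (by omega)) _ (ih b (by omega))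
        rw [mul_sub_mul_eq_of_mul_eq_zero] at e
        · rwa [hm.map_append ha hb]
        · exact (hm.map_append hb ha).symm.trans (hm.map_eq_zero hba)
      · rw [hm.map_eq_zero hs]
        exact L.zero_mem
  rw [eq_top_iff, ← hm.span_range, Submodule.span_le]
  rintro _ ⟨u, rfl⟩
  exact h _ u le_rfl

/-! ### Reduction of elements to monomials -/

variable [IsScalarTower k R R] [SMulCommClass k R R]

/-- Multiplying a nonzero element on both sides by a long context of one of the words in its support
leaves only one word, since the context determines the word inside. -/
theorem exists_mul_mul_eq_map (hm : IsWordAlgebra k w m) (hw : IsFixedPoint φ w)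
    (hw0 : w 0 = .x1) {f : R} (hf : f ≠ 0) :
    ∃ (a b : R) (u : List Letter), u ≠ [] ∧ IsSubword u w ∧ a * f * b = m u := by
  classical
  set c := hm.basis.repr f with hc
  have hc0 : c ≠ 0 := by simpa [hc] using hf
  obtain ⟨s, hs⟩ := Finsupp.support_nonempty_iff.2 hc0
  obtain ⟨K, hK⟩ := hw.exists_context_of_le (c.support.sup fun u => u.1.length)
  have hlen : ∀ u ∈ c.support, u.1.length ≤ c.support.sup fun u => u.1.length := fun u hu =>
    Finset.le_sup (f := fun u : {u : List Letter // IsSubword u w ∧ u ≠ []} => u.1.length) hu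
  obtain ⟨p, hp, hocc⟩ := hw.exists_occursAt_ge hw0 s.2.1 (K + 1)
  set v := window w 0 p with hv
  set z := window w (p + s.1.length) (K + 1) with hz
  have hvne : v ≠ [] := by rw [← List.length_pos_iff, length_window]; omega
  have hzne : z ≠ [] := by rw [← List.length_pos_iff, length_window]; omega
  have hsub : IsSubword (v ++ s.1 ++ z) w := by
    refine isSubword_iff_exists_occursAt.2 ⟨0, occursAt_append.2 ⟨occursAt_append.2
      ⟨occursAt_window _ _, ?_⟩, ?_⟩⟩
    · simpa [hv] using hocc
    · simpa [hv, hz] using occursAt_window (w := w) (p + s.1.length) (K + 1)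
  have huniq : ∀ t ∈ c.support, t ≠ s → ¬ IsSubword (v ++ t.1 ++ z) w := by
    intro t ht hts hsub'
    obtain ⟨j, hj⟩ := isSubword_iff_exists_occursAt.1 hsub'
    rw [occursAt_append, occursAt_append, hv, hz, occursAt_window_iff, occursAt_window_iff,
      List.length_append, length_window] at hj
    obtain ⟨⟨h1, h2⟩, h3⟩ := hj
    obtain ⟨h4, h5⟩ := hK p (j + p) _ _ (hlen s hs) (hlen t ht) (by omega) (by omega)
      (fun r hr => by
        convert h1 (p - K + r) (by omega) using 2 <;> omega)
      (fun r hr => by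
        convert h3 r (by omega) using 2; omega)
    refine hts (Subtype.ext (List.ext_getElem h4.symm fun r hr1 hr2 => ?_))
    rw [h2 r hr1, hocc r hr2, h5 r hr2]
  have hmul : m v * f * m z =
      c s • m (v ++ s.1 ++ z) := by
    conv_lhs => rw [← hm.basis.linearCombination_repr f, ← hc,
      Finsupp.linearCombination_apply, Finsupp.sum]
    rw [Finset.mul_sum, Finset.sum_mul, Finset.sum_eq_single_of_mem s hs]
    · rw [hm.basis_apply, mul_smul_comm, smul_mul_assoc, hm.map_append (by simp [hvne]) hzne,
        hm.map_append hvne s.2.2]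
    · intro t ht hts
      rw [hm.basis_apply, mul_smul_comm, smul_mul_assoc, ← hm.map_append hvne t.2.2,
        ← hm.map_append (by simp [hvne]) hzne, hm.map_eq_zero (huniq t ht hts),
        smul_zero]
  refine ⟨(c s)⁻¹ • m v, m z, v ++ s.1 ++ z, by simp [hvne], hsub, ?_⟩
  rw [smul_mul_assoc, smul_mul_assoc, hmul, smul_smul,
    inv_mul_cancel₀ (Finsupp.mem_support_iff.1 hs), one_smul]

/-- A nonzero set that is closed under left and right multiplications contains all sufficiently
long words. -/
theorem exists_map_mem (hm : IsWordAlgebra k w m) (hw : IsFixedPoint φ w) (hw0 : w 0 = .x1)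
    {I : Set R} (hl : ∀ r, ∀ a ∈ I, r * a ∈ I)
    (hr : ∀ r, ∀ a ∈ I, a * r ∈ I) {f : R} (hf : f ∈ I)
    (hf0 : f ≠ 0) :
    ∃ K, 0 < K ∧ ∀ v, IsSubword v w → K ≤ v.length → m v ∈ I := by
  obtain ⟨a, b, u, hu, hsub, hab⟩ := hm.exists_mul_mul_eq_map hw hw0 hf0
  obtain ⟨K, hK⟩ := hw.exists_eq_append_append hw0 hsub
  refine ⟨K + 1, Nat.succ_pos _, fun v hv hlen => ?_⟩
  obtain ⟨c, d, hc, hd, rfl⟩ := hK v hv (by omega)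
  rw [hm.map_append hc (by simp [hu]), hm.map_append hu hd, ← hab]
  exact hl _ _ (hr _ _ (hr _ _ (hl _ _ hf)))

/-! ### Just infinite and prime -/

theorem isJustInfinite (hm : IsWordAlgebra k w m) (hw : IsFixedPoint φ w) (hw0 : w 0 = .x1) :
    IsJustInfinite k R := by
  refine ⟨fun hfin => ?_, fun I hI hne => ?_⟩
  · have := infinite_subword (w := w)
    exact not_finite_iff_infinite.2 this (Module.Finite.finite_basis (hm.basis))
  · obtain ⟨f, hf, hf0⟩ := I.ne_bot_iff.1 hne
    obtain ⟨K, -, hK⟩ := hm.exists_map_mem hw hw0 (I := I) (fun r a ha => (hI r a ha).1)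
      (fun r a ha => (hI r a ha).2) hf hf0
    refine finite_quotient_of_span_eq_top (hm.span_range)
      ((List.finite_length_le Letter K).image (m)) ?_
    rintro _ ⟨u, rfl⟩
    by_cases hu : u.length ≤ K
    · exact Or.inl ⟨u, hu, rfl⟩
    · refine Or.inr ?_
      by_cases hs : IsSubword u w
      · exact hK u hs (by omega)
      · rw [hm.map_eq_zero hs]
        exact I.zero_mem

theorem exists_map_mem_ideal (hm : IsWordAlgebra k w m) (hw : IsFixedPoint φ w) (hw0 : w 0 = .x1)
    {I : TwoSidedIdeal R} (hI : I ≠ ⊥) :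
    ∃ K, 0 < K ∧ ∀ v, IsSubword v w → K ≤ v.length → m v ∈ I := by
  obtain ⟨f, hf, hf0⟩ := exists_mem_ne_zero_of_ne_bot hI
  exact hm.exists_map_mem hw hw0 (I := (I : Set R))
    (fun r a ha => I.mul_mem_left r a ha) (fun r a ha => I.mul_mem_right a r ha) hf hf0

theorem isPrimeRing (hm : IsWordAlgebra k w m) (hw : IsFixedPoint φ w) (hw0 : w 0 = .x1) :
    IsPrimeRing R := by
  refine ⟨hm.nontrivial, fun I J hIJ => ?_⟩
  by_contra! hne
  obtain ⟨K, hKpos, hK⟩ := hm.exists_map_mem_ideal hw hw0 hne.1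
  obtain ⟨M, hMpos, hM⟩ := hm.exists_map_mem_ideal hw hw0 hne.2
  have hu : window w 0 K ≠ [] := by rw [← List.length_pos_iff, length_window]; exact hKpos
  have hv : window w 0 M ≠ [] := by rw [← List.length_pos_iff, length_window]; exact hMpos
  obtain ⟨z, hz, hsub⟩ := hw.exists_isSubword_append_append hw0 (isSubword_window (w := w) 0 K)
    (isSubword_window 0 M)
  refine hm.map_ne_zero hsub (by simp [hu]) ?_
  rw [← List.append_assoc, hm.map_append (by simp [hu]) hv]
  refine hIJ _ (hK _ (IsSubword.of_append_left (v := window w 0 M) ?_) (by simp)) _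
    (hM _ (isSubword_window _ _) (by simp))
  rwa [List.append_assoc]

/-! ### The Jacobson radical -/

/-- The sum of the words of length `K` acts on sequences as the `K`-th power of the shift, so that
it cannot be quasi-regular: the sequence that changes its sign every `K` places is annihilated by
`1` plus this sum. -/
theorem eq_bot_of_isQuasiregular (hm : IsWordAlgebra k w m) (hw : IsFixedPoint φ w)
    (hw0 : w 0 = .x1) {I : TwoSidedIdeal R} (hI : ∀ a ∈ I, IsQuasiregular a) : I = ⊥ := by
  classical
  by_contra hne
  obtain ⟨K, hKpos, hK⟩ := hm.exists_map_mem_ideal hw hw0 hne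
  set S := (List.finite_length_eq Letter K).toFinset with hS
  have hSmem : ∀ u, u ∈ S ↔ u.length = K := by simp [hS]
  set a := ∑ u ∈ S, m u with ha
  have haI : a ∈ I := by
    refine sum_mem fun u hu => ?_
    by_cases hs : IsSubword u w
    · exact hK u hs ((hSmem u).1 hu).ge
    · rw [hm.map_eq_zero hs]
      exact I.zero_mem
  obtain ⟨b, -, hb⟩ := isQuasiregular_iff.1 (hI a haI)
  obtain ⟨ρ, hρ⟩ := hm.exists_action
  have hact : ∀ (f : ℕ → k) i, ρ a f i = f (i + K) := by
    intro f i
    have hne : ∀ u ∈ S, u ≠ [] := by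
      intro u hu
      rw [← List.length_pos_iff, (hSmem u).1 hu]
      exact hKpos
    have hmem : window w i K ∈ S := (hSmem _).2 (by simp)
    rw [ha, map_sum, LinearMap.sum_apply, Finset.sum_apply, Finset.sum_eq_single_of_mem _ hmem]
    · rw [(hρ _ (hne _ hmem) f i).1 (occursAt_window i K), length_window]
    · intro u hu huw
      refine (hρ u (hne u hu) f i).2 fun ho => huw ?_
      rw [ho.eq_window, (hSmem u).1 hu]
  let f : ℕ → k := fun i => (-1) ^ (i / K)
  have hf : ρ a f = -f := by
    funext i
    rw [hact, Pi.neg_apply]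
    simp only [f]
    rw [Nat.add_div_right _ hKpos, pow_succ, mul_neg_one]
  have hb' := congrArg (fun x => ρ x f 0) hb
  simp only [map_add, map_mul, map_zero, LinearMap.add_apply, Module.End.mul_apply, hf, map_neg,
    LinearMap.zero_apply, Pi.add_apply, Pi.neg_apply, Pi.zero_apply] at hb'
  simp [f] at hb'

theorem jacobsonRadical_eq_bot (hm : IsWordAlgebra k w m) (hw : IsFixedPoint φ w)
    (hw0 : w 0 = .x1) :
    jacobsonRadical R = ⊥ :=
  le_bot_iff.1 (sSup_le fun _ hI => (hm.eq_bot_of_isQuasiregular hw hw0 hI).le)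

/-! ### Graded nilpotence -/


theorem mul_mem_span_image (hm : IsWordAlgebra k w m) {s t r : Set (List Letter)}
    (h : ∀ v ∈ s, ∀ z ∈ t, v ++ z ∈ r) {a b : R} (ha : a ∈ Submodule.span k (m '' s))
    (hb : b ∈ Submodule.span k (m '' t)) : a * b ∈ Submodule.span k (m '' r) := by
  refine mul_mem_of_mem_span ?_ ha hb
  rintro _ ⟨v, hv, rfl⟩ _ ⟨z, hz, rfl⟩
  by_cases hvne : v = []
  · rw [hvne, hm.map_nil, zero_mul]
    exact Submodule.zero_mem _
  by_cases hzne : z = []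
  · rw [hzne, hm.map_nil, mul_zero]
    exact Submodule.zero_mem _
  exact Submodule.subset_span ⟨v ++ z, h v hv z hz, hm.map_append hvne hzne⟩

theorem setPow_subset_span_isBlockProduct (hm : IsWordAlgebra k w m) {d : ℕ} {S : Set R}
    (hS : S ⊆ Submodule.span k (m '' {u | (u.map letterDegree).sum = d})) (n : ℕ) :
    setPow S n ⊆ Submodule.span k (m '' {u | IsBlockProduct letterDegree d n u}) := by
  induction n with
  | zero => exact hS
  | succ n ih =>
    rintro _ ⟨a, ha, b, hb, rfl⟩
    exact hm.mul_mem_span_image (r := {u | IsBlockProduct letterDegree d (n + 1) u})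
      (fun v hv z hz => ⟨v, z, rfl, hv, hz⟩) (ih ha) (hS hb)

theorem isGradedNilpotent (hm : IsWordAlgebra k w m) (hw : IsFixedPoint φ w) (hw0 : w 0 = .x1)
    {𝒜 : ℕ → Submodule k R}
    (h𝒜 : ∀ d, 𝒜 d = Submodule.span k (m '' {u | (u.map letterDegree).sum = d})) :
    IsGradedNilpotent k R 𝒜 where
  isInternal := by
    rw [show 𝒜 = _ from funext h𝒜]
    exact hm.isInternal_span
  mul_mem i j a ha b hb := by
    rw [h𝒜] at ha hb ⊢
    refine hm.mul_mem_span_image ?_ ha hb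
    rintro v rfl z rfl
    simp
  isNilpotentSet d S hS := by
    rw [h𝒜] at hS
    have hzero : ∀ N, (∀ u, IsBlockProduct letterDegree d N u → m u = 0) → IsNilpotentSet S := by
      refine fun N hN => ⟨N, fun x hx => ?_⟩
      have hle : Submodule.span k (m '' {u | IsBlockProduct letterDegree d N u}) ≤ ⊥ := by
        rw [Submodule.span_le]
        rintro _ ⟨u, hu, rfl⟩
        exact hN u hu
      exact hle (hm.setPow_subset_span_isBlockProduct hS N hx)
    rcases Nat.eq_zero_or_pos d with rfl | hd
    · refine hzero 0 fun u hu => ?_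
      by_cases hne : u = []
      · rw [hne, hm.map_nil]
      · exact absurd hu (sum_letterDegree_pos hne).ne'
    · obtain ⟨N, hN⟩ := hw.exists_isBlockProduct_not_isSubword hw0 hd
      exact hzero N fun u hu => hm.map_eq_zero (hN u hu)

end IsWordAlgebra

/-! ### The number of subwords -/

section Count

variable {w : ℕ → Letter}

open Classical in
/-- The nonempty subwords of `w` of length at most `n`. -/
noncomputable def subwordsUpTo (w : ℕ → Letter) (n : ℕ) : Finset (List Letter) :=
  {u ∈ (List.finite_length_le Letter n).toFinset | IsSubword u w ∧ u ≠ []}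

theorem mem_subwordsUpTo {n : ℕ} {u : List Letter} :
    u ∈ subwordsUpTo w n ↔ u.length ≤ n ∧ IsSubword u w ∧ u ≠ [] := by
  simp [subwordsUpTo]

/-- All pairs of consecutive letters of `w` occur within a bounded prefix. -/
theorem exists_pair_lt (w : ℕ → Letter) :
    ∃ B, ∀ i, ∃ j < B, w i = w j ∧ w (i + 1) = w (j + 1) := by
  classical
  let f : Letter × Letter → ℕ := fun p =>
    if h : ∃ j, p.1 = w j ∧ p.2 = w (j + 1) then h.choose else 0
  refine ⟨Finset.univ.sup f + 1, fun i => ⟨f (w i, w (i + 1)), ?_, ?_⟩⟩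
  · exact Nat.lt_succ_of_le (Finset.le_sup (f := f) (Finset.mem_univ _))
  · have h : ∃ j, w i = w j ∧ w (i + 1) = w (j + 1) := ⟨i, rfl, rfl⟩
    have hf : f (w i, w (i + 1)) = h.choose := dif_pos h
    rw [hf]
    exact h.choose_spec

/-- A word of length at most `q = 4 ^ m` is determined by two consecutive letters of `w` and an
offset less than `q`, so that it occurs within a prefix of length linear in `q`. -/
theorem IsFixedPoint.card_subwordsUpTo_le (hw : IsFixedPoint φ w) :
    ∃ C, ∀ n, (subwordsUpTo w n).card ≤ C * n ^ 2 := by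
  obtain ⟨B, hB⟩ := exists_pair_lt w
  refine ⟨8 * B, fun n => ?_⟩
  rcases Nat.eq_zero_or_pos n with rfl | hn
  · have h : subwordsUpTo w 0 = ∅ := by
      ext u
      simpa [mem_subwordsUpTo] using fun h _ => h
    simp [h]
  set q := 4 ^ (Nat.log 4 n + 1) with hq
  have hnq : n < q := Nat.lt_pow_succ_log_self (by norm_num) n
  have hqn : q ≤ 4 * n := by
    have h := Nat.pow_log_le_self 4 hn.ne'
    rw [hq, pow_succ]
    omega
  have hsub : subwordsUpTo w n ⊆
      (Finset.range (q * B) ×ˢ Finset.range (n + 1)).image fun p => window w p.1 p.2 := by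
    intro u hu
    obtain ⟨hlen, hs, -⟩ := mem_subwordsUpTo.1 hu
    obtain ⟨i, hi⟩ := isSubword_iff_exists_occursAt.1 hs
    have hpos : 0 < q := by omega
    obtain ⟨j, hj, h0, h1⟩ := hB (i / q)
    have hdm := Nat.div_add_mod i q
    have hlt := Nat.mod_lt i hpos
    have hj' : q * (j + 1) ≤ q * B := Nat.mul_le_mul_left _ hj
    rw [Finset.mem_image]
    refine ⟨(q * j + i % q, u.length), ?_, ?_⟩
    · rw [Finset.mem_product, Finset.mem_range, Finset.mem_range]
      constructor
      · change q * j + i % q < q * B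
        rw [mul_add, mul_one] at hj'
        omega
      · exact Nat.lt_succ_of_le hlen
    · refine (OccursAt.eq_window fun t ht => ?_).symm
      rw [hi t ht]
      rcases Nat.lt_or_ge (i % q + t) q with h | h
      · have e := hw.apply_pow_mul_add (Nat.log 4 n + 1) h0 (i % q + t) h
        rw [← hq] at e
        convert e using 2 <;> omega
      · have e := hw.apply_pow_mul_add (Nat.log 4 n + 1) h1 (i % q + t - q) (by omega)
        rw [← hq, mul_add, mul_add, mul_one] at e
        convert e using 2 <;> omega
  calc (subwordsUpTo w n).card ≤ _ := Finset.card_le_card hsub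
    _ ≤ _ := Finset.card_image_le
    _ = q * B * (n + 1) := by rw [Finset.card_product, Finset.card_range, Finset.card_range]
    _ ≤ 4 * n * B * (n + n) := by gcongr; omega
    _ = 8 * B * n ^ 2 := by ring

/-- By synchronization, the windows of a length of at least `2 * q`, where `q = 4 ^ s`, that
start at the positions below `q` are distinct. -/
theorem IsFixedPoint.le_card_subwordsUpTo (hw : IsFixedPoint φ w) {n : ℕ} (hn : 4 ≤ n) :
    n ^ 2 ≤ 128 * (subwordsUpTo w n).card := by
  have hlog : 1 ≤ Nat.log 4 n := Nat.log_pos (by norm_num) hn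
  obtain ⟨s, hs⟩ : ∃ s, Nat.log 4 n = s + 1 := ⟨Nat.log 4 n - 1, by omega⟩
  have h1 := Nat.pow_log_le_self 4 (show n ≠ 0 by omega)
  have h2 := Nat.lt_pow_succ_log_self (b := 4) (by norm_num) n
  rw [hs, pow_succ] at h1
  rw [hs, pow_succ, pow_succ] at h2
  set q := 4 ^ s with hq
  have hpos : 0 < q := by positivity
  have hsub : (Finset.range q ×ˢ Finset.range (2 * q)).image
      (fun p => window w p.1 (2 * q + p.2)) ⊆ subwordsUpTo w n := by
    intro u hu
    obtain ⟨p, hp, rfl⟩ := Finset.mem_image.1 hu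
    rw [Finset.mem_product, Finset.mem_range, Finset.mem_range] at hp
    refine mem_subwordsUpTo.2 ⟨?_, isSubword_window _ _, ?_⟩
    · rw [length_window]
      omega
    · rw [← List.length_pos_iff, length_window]
      omega
  have hinj : Set.InjOn (fun p : ℕ × ℕ => window w p.1 (2 * q + p.2))
      (Finset.range q ×ˢ Finset.range (2 * q) : Finset (ℕ × ℕ)) := by
    rintro ⟨i, l⟩ hi ⟨j, l'⟩ hj h
    rw [Finset.mem_coe, Finset.mem_product, Finset.mem_range, Finset.mem_range] at hi hj
    have hl : l = l' := by
      have e := congrArg List.length h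
      simp only [length_window] at e
      omega
    subst hl
    have hocc : OccursAt (window w i (2 * q + l)) w j := by
      rw [show window w i (2 * q + l) = window w j (2 * q + l) from h]
      exact occursAt_window _ _
    have e := hw.modEq_of_agree s i j fun t ht => occursAt_window_iff.1 hocc t (by omega)
    rw [Nat.ModEq.eq_of_lt_of_lt e hi.1 hj.1]
  have hcard := Finset.card_le_card hsub
  rw [Finset.card_image_of_injOn hinj, Finset.card_product, Finset.card_range,
    Finset.card_range] at hcard
  calc n ^ 2 ≤ (q * 4 * 4) ^ 2 := by gcongr
    _ = 128 * (q * (2 * q)) := by ring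
    _ ≤ _ := by gcongr

end Count

/-! ### Growth of algebras -/

section Growth

variable {k : Type*} [Field k] {R : Type*} [NonUnitalRing R] [Module k R]

/-- The space `V + V ^ 2 + ⋯ + V ^ n`. -/
def powerSum (V : Submodule k R) (n : ℕ) : Submodule k R :=
  Submodule.span k (⋃ i < n, setPow (V : Set R) i)

theorem growth_eq_finrank (V : Submodule k R) (n : ℕ) :
    growth V n = Module.finrank k (powerSum V n) :=
  rfl

theorem powerSum_mono (V : Submodule k R) : Monotone (powerSum V) := fun _ _ h =>
  Submodule.span_mono (Set.biUnion_subset_biUnion_left fun _ hi => lt_of_lt_of_le hi h)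

theorem setPow_subset_powerSum (V : Submodule k R) {i n : ℕ} (h : i < n) :
    setPow (V : Set R) i ⊆ powerSum V n := fun _ hx =>
  Submodule.subset_span (Set.mem_biUnion (show i ∈ {i | i < n} from h) hx)

theorem mul_mem_setPow {S : Set R} {i j : ℕ} {a b : R} (ha : a ∈ setPow S i)
    (hb : b ∈ setPow S j) : a * b ∈ setPow S (i + j + 1) := by
  induction j generalizing b with
  | zero => exact Set.mul_mem_mul ha hb
  | succ j ih =>
    obtain ⟨c, hc, d, hd, rfl⟩ := hb
    change a * (c * d) ∈ _
    rw [← mul_assoc]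
    exact Set.mul_mem_mul (ih hc) hd

variable [IsScalarTower k R R] [SMulCommClass k R R]

theorem mul_mem_powerSum {V : Submodule k R} {p q : ℕ} {x y : R} (hx : x ∈ powerSum V p)
    (hy : y ∈ powerSum V q) : x * y ∈ powerSum V (p + q) := by
  refine mul_mem_of_mem_span (fun a ha b hb => ?_) hx hy
  simp only [Set.mem_iUnion] at ha hb
  obtain ⟨i, hi, ha⟩ := ha
  obtain ⟨j, hj, hb⟩ := hb
  exact setPow_subset_powerSum V (by omega) (mul_mem_setPow ha hb)

/-- The powers of a generating subspace exhaust the algebra. -/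
theorem exists_mem_powerSum {V : Submodule k R}
    (hV : NonUnitalAlgebra.adjoin k (V : Set R) = ⊤) (x : R) : ∃ q, x ∈ powerSum V q := by
  have hx : x ∈ NonUnitalAlgebra.adjoin k (V : Set R) := by
    rw [hV]
    trivial
  induction hx using NonUnitalAlgebra.adjoin_induction with
  | mem x hx => exact ⟨1, setPow_subset_powerSum V one_pos hx⟩
  | add x y _ _ hx hy =>
    obtain ⟨p, hp⟩ := hx
    obtain ⟨q, hq⟩ := hy
    exact ⟨p + q, add_mem (powerSum_mono V (Nat.le_add_right p q) hp)
      (powerSum_mono V (Nat.le_add_left q p) hq)⟩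
  | zero => exact ⟨0, Submodule.zero_mem _⟩
  | mul x y _ _ hx hy =>
    obtain ⟨p, hp⟩ := hx
    obtain ⟨q, hq⟩ := hy
    exact ⟨p + q, mul_mem_powerSum hp hq⟩
  | smul c x _ hx => exact hx.imp fun q hq => Submodule.smul_mem _ c hq

end Growth

namespace IsWordAlgebra

variable {k : Type*} [Field k] {w : ℕ → Letter} {R : Type*} [NonUnitalRing R] [Module k R]
  {m : List Letter → R}

theorem span_length_le_eq (hm : IsWordAlgebra k w m) (n : ℕ) :
    Submodule.span k (m '' {u | u.length ≤ n}) =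
      Submodule.span k (Set.range fun u : subwordsUpTo w n => m u) := by
  rw [hm.span_image_eq]
  congr 1
  ext x
  constructor
  · rintro ⟨u, hu, rfl⟩
    exact ⟨⟨u.1, mem_subwordsUpTo.2 ⟨hu, u.2⟩⟩, (hm.basis_apply u).symm⟩
  · rintro ⟨u, rfl⟩
    obtain ⟨h1, h2⟩ := mem_subwordsUpTo.1 u.2
    exact ⟨⟨u.1, h2⟩, h1, hm.basis_apply _⟩

theorem finrank_span_length_le (hm : IsWordAlgebra k w m) (n : ℕ) :
    Module.finrank k (Submodule.span k (m '' {u | u.length ≤ n})) =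
      (subwordsUpTo w n).card := by
  have hli : LinearIndependent k fun u : subwordsUpTo w n => m u :=
    hm.linearIndependent.comp
      (fun u : subwordsUpTo w n => ⟨u.1, (mem_subwordsUpTo.1 u.2).2⟩)
      fun u v huv => Subtype.ext (Subtype.mk.inj huv)
  rw [hm.span_length_le_eq, finrank_span_eq_card hli, Fintype.card_coe]

theorem finite_span_length_le (m : List Letter → R) (n : ℕ) :
    Module.Finite k (Submodule.span k (m '' {u | u.length ≤ n})) :=
  Module.Finite.span_of_finite k ((List.finite_length_le Letter n).image m)

theorem exists_mem_span_length_le (hm : IsWordAlgebra k w m) (x : R) :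
    ∃ c, x ∈ Submodule.span k (m '' {u | u.length ≤ c}) := by
  have hmono : ∀ {a b : ℕ}, a ≤ b → Submodule.span k (m '' {u | u.length ≤ a}) ≤
      Submodule.span k (m '' {u | u.length ≤ b}) := fun h =>
    Submodule.span_mono (Set.image_mono fun _ hu => le_trans hu h)
  have hx : x ∈ Submodule.span k (Set.range m) := by
    rw [hm.span_range]
    trivial
  induction hx using Submodule.span_induction with
  | mem x hx =>
    obtain ⟨u, rfl⟩ := hx
    exact ⟨u.length, Submodule.subset_span ⟨u, le_refl u.length, rfl⟩⟩
  | zero => exact ⟨0, Submodule.zero_mem _⟩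
  | add x y _ _ hx hy =>
    obtain ⟨a, ha⟩ := hx
    obtain ⟨b, hb⟩ := hy
    exact ⟨a + b, add_mem (hmono (Nat.le_add_right a b) ha) (hmono (Nat.le_add_left b a) hb)⟩
  | smul c x _ hx => exact hx.imp fun q hq => Submodule.smul_mem _ c hq

theorem exists_le_span_length_le (hm : IsWordAlgebra k w m) {V : Submodule k R}
    (hV : Module.Finite k V) : ∃ c, V ≤ Submodule.span k (m '' {u | u.length ≤ c}) := by
  obtain ⟨s, hs⟩ := Module.Finite.iff_fg.1 hV
  choose c hc using hm.exists_mem_span_length_le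
  refine ⟨s.sup c, ?_⟩
  rw [← hs, Submodule.span_le]
  intro x hx
  have hle : c x ≤ s.sup c := Finset.le_sup hx
  have hmono : Submodule.span k (m '' {u | u.length ≤ c x}) ≤
      Submodule.span k (m '' {u | u.length ≤ s.sup c}) :=
    Submodule.span_mono (Set.image_mono fun u (hu : u.length ≤ c x) => hu.trans hle)
  exact hmono (hc x)

variable [IsScalarTower k R R] [SMulCommClass k R R]

theorem powerSum_le (hm : IsWordAlgebra k w m) {V : Submodule k R} {c : ℕ}
    (hV : V ≤ Submodule.span k (m '' {u | u.length ≤ c})) (n : ℕ) :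
    powerSum V n ≤ Submodule.span k (m '' {u | u.length ≤ c * n}) := by
  have h : ∀ i, setPow (V : Set R) i ⊆
      Submodule.span k (m '' {u | u.length ≤ c * (i + 1)}) := by
    intro i
    induction i with
    | zero =>
      rw [Nat.zero_add, mul_one]
      exact hV
    | succ i ih =>
      rintro _ ⟨a, ha, b, hb, rfl⟩
      refine hm.mul_mem_span_image (fun v hv z hz => ?_) (ih ha) (hV hb)
      rw [Set.mem_ofPred_eq] at hv hz ⊢
      rw [List.length_append, mul_add c (i + 1), mul_one]
      exact add_le_add hv hz
  refine Submodule.span_le.2 (Set.iUnion₂_subset fun i hi => (h i).trans ?_)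
  exact Submodule.span_mono (Set.image_mono fun u hu =>
    le_trans hu (Nat.mul_le_mul_left c hi))

theorem exists_le_powerSum (hm : IsWordAlgebra k w m) {V : Submodule k R}
    (hV : NonUnitalAlgebra.adjoin k (V : Set R) = ⊤) :
    ∃ q, 0 < q ∧ ∀ n, Submodule.span k (m '' {u | u.length ≤ n}) ≤ powerSum V (q * n) := by
  choose f hf using fun a : Letter => exists_mem_powerSum hV (m [a])
  set q := Finset.univ.sup f + 1 with hq
  have hletter : ∀ a, m [a] ∈ powerSum V q := fun a =>
    powerSum_mono V ((Finset.le_sup (Finset.mem_univ a)).trans (Nat.le_succ _)) (hf a)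
  refine ⟨q, Nat.succ_pos _, fun n => ?_⟩
  rw [Submodule.span_le]
  rintro _ ⟨u, hu, rfl⟩
  have hword : ∀ u : List Letter, m u ∈ powerSum V (q * u.length) := by
    intro u
    induction u with
    | nil =>
      rw [hm.map_nil]
      exact Submodule.zero_mem _
    | cons a u ih =>
      by_cases hne : u = []
      · rw [hne, List.length_singleton, mul_one]
        exact hletter a
      · rw [← List.singleton_append, hm.map_append (by simp) hne, List.length_append,
          List.length_singleton, mul_add, mul_one]
        exact mul_mem_powerSum (hletter a) ih
  exact powerSum_mono V (Nat.mul_le_mul_left q hu) (hword u)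

/-- The dimension of `V + ⋯ + V ^ n` is bounded above and below by multiples of `n ^ 2`. -/
theorem exists_growth_bounds (hm : IsWordAlgebra k w m) (hw : IsFixedPoint φ w)
    {V : Submodule k R} (hV : IsGeneratingSubspace k R V) :
    ∃ A B N : ℕ, 0 < A ∧ 0 < B ∧ ∀ n ≥ N, n ^ 2 ≤ A * growth V n ∧ growth V n ≤ B * n ^ 2 := by
  obtain ⟨c, hc⟩ := hm.exists_le_span_length_le hV.1
  obtain ⟨q, hq0, hq⟩ := hm.exists_le_powerSum hV.2
  obtain ⟨C, hC⟩ := hw.card_subwordsUpTo_le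
  have hfin : ∀ n, Module.Finite k (powerSum V n) := fun n => by
    have := finite_span_length_le (k := k) m (c * n)
    exact Submodule.finiteDimensional_of_le (hm.powerSum_le hc n)
  refine ⟨4 * q ^ 2 * 128, C * c ^ 2 + 1, 4 * q, by positivity, by positivity, fun n hn => ⟨?_, ?_⟩⟩
  · have hdiv : 4 ≤ n / q := (Nat.le_div_iff_mul_le hq0).2 hn
    have hcard : (subwordsUpTo w (n / q)).card ≤ growth V n := by
      rw [← hm.finrank_span_length_le, growth_eq_finrank]
      have := hfin n
      exact Submodule.finrank_mono
        ((hq (n / q)).trans (powerSum_mono V (Nat.mul_div_le n q)))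
    have hle : n ≤ 2 * q * (n / q) := by
      have h1 := Nat.div_add_mod n q
      have h2 := Nat.mod_lt n hq0
      have h3 : q * 1 ≤ q * (n / q) := Nat.mul_le_mul_left q (by omega)
      rw [mul_assoc]
      omega
    calc n ^ 2 ≤ (2 * q * (n / q)) ^ 2 := by gcongr
      _ = 4 * q ^ 2 * (n / q) ^ 2 := by ring
      _ ≤ 4 * q ^ 2 * (128 * (subwordsUpTo w (n / q)).card) := by
        gcongr
        exact hw.le_card_subwordsUpTo hdiv
      _ ≤ 4 * q ^ 2 * (128 * growth V n) := by gcongr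
      _ = 4 * q ^ 2 * 128 * growth V n := by ring
  · have := finite_span_length_le (k := k) m (c * n)
    calc growth V n ≤ (subwordsUpTo w (c * n)).card := by
          rw [← hm.finrank_span_length_le, growth_eq_finrank]
          exact Submodule.finrank_mono (hm.powerSum_le hc n)
      _ ≤ C * (c * n) ^ 2 := hC _
      _ = C * c ^ 2 * n ^ 2 := by ring
      _ ≤ (C * c ^ 2 + 1) * n ^ 2 := by gcongr; omega

theorem isFinitelyGenerated (hm : IsWordAlgebra k w m) : IsFinitelyGenerated k R := by
  refine ⟨Submodule.span k (m '' {u | u.length ≤ 1}), finite_span_length_le m 1, ?_⟩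
  set S := NonUnitalAlgebra.adjoin k
    (Submodule.span k (m '' {u | u.length ≤ 1}) : Set R) with hS
  have hword : ∀ u, m u ∈ S := by
    intro u
    induction u with
    | nil =>
      rw [hm.map_nil]
      exact zero_mem _
    | cons a u ih =>
      have ha : m [a] ∈ S :=
        NonUnitalAlgebra.subset_adjoin k (Submodule.subset_span ⟨[a], le_refl 1, rfl⟩)
      by_cases hne : u = []
      · rwa [hne]
      · rw [← List.singleton_append, hm.map_append (by simp) hne]
        exact mul_mem ha ih
  have hle : Submodule.span k (Set.range m) ≤ NonUnitalSubalgebra.toSubmodule S := by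
    rw [Submodule.span_le]
    rintro _ ⟨u, rfl⟩
    exact hword u
  rw [hm.span_range] at hle
  rw [eq_top_iff]
  exact fun x _ => hle (Submodule.mem_top (x := x))

theorem hasQuadraticGrowth (hm : IsWordAlgebra k w m) (hw : IsFixedPoint φ w) :
    HasQuadraticGrowth k R := by
  refine ⟨hm.isFinitelyGenerated, fun V hV => ?_⟩
  obtain ⟨A, B, N, hA, hB, h⟩ := hm.exists_growth_bounds hw hV
  constructor
  · refine Asymptotics.IsBigO.of_bound B ?_
    filter_upwards [Filter.eventually_ge_atTop N] with n hn
    rw [Real.norm_of_nonneg (by positivity), Real.norm_of_nonneg (by positivity)]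
    exact_mod_cast (h n hn).2
  · refine Asymptotics.IsBigO.of_bound A ?_
    filter_upwards [Filter.eventually_ge_atTop N] with n hn
    rw [Real.norm_of_nonneg (by positivity), Real.norm_of_nonneg (by positivity)]
    exact_mod_cast (h n hn).1

theorem hasGKDim_two (hm : IsWordAlgebra k w m) (hw : IsFixedPoint φ w) : HasGKDim k R 2 := by
  refine ⟨hm.isFinitelyGenerated, fun V hV => ?_⟩
  obtain ⟨A, B, N, hA, hB, h⟩ := hm.exists_growth_bounds hw hV
  have hlog : Filter.Tendsto (fun n : ℕ => Real.log n) Filter.atTop Filter.atTop :=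
    Real.tendsto_log_atTop.comp tendsto_natCast_atTop_atTop
  have hlim : ∀ c : ℝ, Filter.Tendsto (fun n : ℕ => 2 + c / Real.log n) Filter.atTop
      (nhds 2) := fun c => by
    simpa using (hlog.const_div_atTop c).const_add 2
  have hA' : (0 : ℝ) < A := by exact_mod_cast hA
  have hB' : (0 : ℝ) < B := by exact_mod_cast hB
  have hreal : Filter.Tendsto (fun n : ℕ => Real.log (growth V n) / Real.log n) Filter.atTop
      (nhds 2) := by
    refine tendsto_of_tendsto_of_tendsto_of_le_of_le' (hlim (-Real.log A)) (hlim (Real.log B))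
      ?_ ?_
    all_goals
      filter_upwards [Filter.eventually_ge_atTop (max N 2)] with n hn
      have hn2 : 2 ≤ n := (le_max_right _ _).trans hn
      obtain ⟨h1, h2⟩ := h n ((le_max_left _ _).trans hn)
      have hnpos : (0 : ℝ) < n := by exact_mod_cast (by omega : 0 < n)
      have hlogpos : 0 < Real.log n := Real.log_pos (by exact_mod_cast (by omega : 1 < n))
      have h1' : (n : ℝ) ^ 2 ≤ A * growth V n := by exact_mod_cast h1
      have h2' : (growth V n : ℝ) ≤ B * (n : ℝ) ^ 2 := by exact_mod_cast h2
      have hgpos : (0 : ℝ) < growth V n := by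
        by_contra hle
        have : (n : ℝ) ^ 2 ≤ 0 := h1'.trans (mul_nonpos_of_nonneg_of_nonpos hA'.le (not_lt.1 hle))
        exact absurd this (not_le.2 (by positivity))
    · have e := Real.log_le_log (by positivity) h1'
      rw [Real.log_mul hA'.ne' hgpos.ne', Real.log_pow] at e
      rw [le_div_iff₀ hlogpos, add_mul, div_mul_cancel₀ _ hlogpos.ne']
      push_cast at e
      linarith
    · have e := Real.log_le_log hgpos h2'
      rw [Real.log_mul hB'.ne' (by positivity), Real.log_pow] at e
      rw [div_le_iff₀ hlogpos, add_mul, div_mul_cancel₀ _ hlogpos.ne']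
      push_cast at e
      linarith
  exact ((continuous_coe_real_ereal.tendsto 2).comp hreal).limsup_eq

end IsWordAlgebra

end Iterative

open Iterative in
theorem theorem1 (k : Type*) [Field k] (w : ℕ → Letter)
    (hw0 : w 0 = Letter.x1) (hw : IsFixedPoint φ w) :
    IsJustInfinite k (positivePart k w letterDegree) ∧
    IsPrimeRing (positivePart k w letterDegree) ∧
    IsGradedNilpotent k (positivePart k w letterDegree)
      (positivePiece k w letterDegree) ∧
    HasQuadraticGrowth k (positivePart k w letterDegree) ∧
    HasGKDim k (positivePart k w letterDegree) 2 ∧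
    jacobsonRadical (positivePart k w letterDegree) = ⊥ ∧
    IsFinitelyGeneratedLie k (positivePart k w letterDegree) ∧
    jacobsonRadical (positivePart k w letterDegree) ≠ ⊤ ∧
    ¬ IsNilpotentSet (Set.univ : Set (positivePart k w letterDegree)) := by
  have hm := isWordAlgebra_posMonomial k w
  have hJ := hm.jacobsonRadical_eq_bot hw hw0
  exact ⟨hm.isJustInfinite hw hw0, hm.isPrimeRing hw hw0,
    hm.isGradedNilpotent hw hw0 (positivePiece_eq_span k w), hm.hasQuadraticGrowth hw,
    hm.hasGKDim_two hw, hJ, hm.isFinitelyGeneratedLie hw, hm.jacobsonRadical_ne_top hJ,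
    hm.not_isNilpotentSet_univ⟩
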